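/- Fix a base $b>1$ for all logarithms. Let $X$ be a random variable with distribution $P_X$ on a finite or countably infinite alphabet $\mathcal X$. Put $\imath(x)=\log\frac1{P_X(x)}$, $H=\mathbb E[\imath(X)]$, $V=\mathrm{Var}[\imath(X)]$, $T=\mathbb E[|\imath(X)-H|^3]$, and assume $V>0$ and $T<\infty$. Let $X_1,X_2,\dots$ be i.i.d. with distribution $P_X$ (a stationary memoryless source). For $n\ge1$ let $M^*(n,\epsilon)$ be the smallest $M$ for which there are an encoder $f:\mathcal X^n\to\{1,\dots,M\}$ and a decoder $g:\{1,\dots,M\}\to\mathcal X^n$ with $\mathbb P[g(f(X^n))\ne X^n]\le\epsilon$, and let $R^*(n,\epsilon)=\frac1n\log M^*(n,\epsilon)$. Let $\Phi$ and $\phi$ be the standard Gaussian distribution function and density, and $Q=1-\Phi$. Let $C_0$ be the absolute constant in the Berry–Esseen inequality for i.i.d. random variables, i.e. the smallest constant such that $\left|\mathbb P\left[\frac1{\sqrt{n v}}\sum_{i=1}^n(Z_i-\mathbb E Z_i)\ge t\right]-Q(t)\right|\le\frac{C_0\,\tau}{v^{3/2}\sqrt n}$ for all $n\ge1$, all real $t$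 and all i.i.d. real $Z_1,\dots,Z_n$ with $v=\mathrm{Var}[Z_1]>0$ and $\tau=\mathbb E|Z_1-\mathbb E Z_1|^3<\infty$. Put $$B=C_0\frac{T}{V^{3/2}},\qquad C=2\left(\frac{\log 2}{\sqrt{2\pi V}}+2B\right).$$ Then, for every $0<\epsilon<1$, there is a remainder $\xi(n)$ such that for all $n\ge1$ $$R^*(n,\epsilon)\le H+\sqrt{\frac Vn}\,Q^{-1}(\epsilon)-\frac{\log n}{2n}+\xi(n),$$ where $\xi(n)=O(1/n)$, in the sense that $0\le\xi(n)\le c/n$ for all $n>n_0$, for some finite $c,n_0\ge0$, and moreover: 1) if $0<\epsilon\le\frac12$, then for all $n>\left(\frac{B+C}{\epsilon}\right)^2$, $$\xi(n)\le\frac1n\log C+\frac1n\,\frac{\sqrt V\,(B+C)}{\phi\left(\Phi^{-1}\left(\Phi(Q^{-1}(\epsilon))+\frac{B+C}{\sqrt n}\right)\right)};$$ 2) if $\frac12<\epsilon<1$, then for all $n>\left(\frac{B+C}{\epsilon-\frac12}\right)^2$, $$\xi(n)\le\frac1n\log C+\frac1n\,\frac{\sqrt V\,(B+C)}{\phi(Q^{-1}(\epsilon))}.$$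 -/

import Mathlib

open MeasureTheory ProbabilityTheory

noncomputable section

namespace SourceCoding

/-! ### Gaussian functions -/

/-- The standard Gaussian cumulative distribution function `Φ`. -/
def Phi (z : ℝ) : ℝ := cdf (gaussianReal 0 1) z

/-- The complementary standard Gaussian cumulative distribution function `Q = 1 - Φ`. -/
def Q (z : ℝ) : ℝ := 1 - Phi z

/-- The inverse of `Φ : ℝ → (0, 1)`; it is only used at arguments in `(0, 1)`. -/
def PhiInv : ℝ → ℝ := Function.invFun Phi

/-- The inverse of `Q : ℝ → (0, 1)`; it is only used at arguments in `(0, 1)`. -/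
def QInv : ℝ → ℝ := Function.invFun Q

/-- The standard Gaussian density `φ(z) = exp (-z² / 2) / √(2π)`. -/
def gaussDensity (z : ℝ) : ℝ := gaussianPDFReal 0 1 z

/-! ### The Berry-Esseen constant -/

/-- `c` is admissible in the Berry-Esseen inequality for i.i.d. random variables: for all `n ≥ 1`,
all i.i.d. real `Z₁, …, Zₙ` (with law `μ`) of finite third absolute moment and variance `V > 0`,
and all real `t`,
`|ℙ[(1/√(nV)) ∑ (Zᵢ - 𝔼 Zᵢ) ≥ t] - Q(t)| ≤ c T / (V^{3/2} √n)`, where `T = 𝔼 |Z₁ - 𝔼 Z₁|³`. -/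
def IsBerryEsseenConstant (c : ℝ) : Prop :=
  ∀ (μ : Measure ℝ) [IsProbabilityMeasure μ], MemLp id 3 μ → 0 < variance id μ →
    ∀ n : ℕ, 1 ≤ n → ∀ t : ℝ,
      |(Measure.pi (fun _ : Fin n => μ)).real
            {z | t ≤ 1 / √((n : ℝ) * variance id μ) * ∑ i, (z i - ∫ x, x ∂μ)} - Q t|
        ≤ c * (∫ y, |y - ∫ x, x ∂μ| ^ 3 ∂μ) / (variance id μ ^ (3 / 2 : ℝ) * √(n : ℝ))

/-- The absolute constant `C₀` of the Berry-Esseen inequality for i.i.d. random variables, that is,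
the smallest admissible constant. -/
def C₀ : ℝ := sInf {c : ℝ | IsBerryEsseenConstant c}

/-! ### Information quantities, in the information unit fixed by the base `b` of the logarithm -/

section Info

variable {𝒳 : Type*} [MeasurableSpace 𝒳]

/-- The information `ı(x) = log (1 / P(x))`. -/
def info (b : ℝ) (P : Measure 𝒳) (x : 𝒳) : ℝ := Real.logb b (1 / P.real {x})

/-- The entropy `H(X) = 𝔼[ı(X)]`. -/
def entropy (b : ℝ) (P : Measure 𝒳) : ℝ := ∫ x, info b P x ∂P

/-- The varentropy `V(X) = Var[ı(X)]`. -/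
def varentropy (b : ℝ) (P : Measure 𝒳) : ℝ := variance (info b P) P

/-- The third centered absolute moment of information `T(X) = 𝔼[|ı(X) - H(X)|³]`, possibly `∞`.
(When `H(X) = ∞`, the integral defining `entropy` is `0` and `T(X) = 𝔼[ı(X)³] = ∞`.) -/
def thirdMoment (b : ℝ) (P : Measure 𝒳) : ENNReal :=
  ∫⁻ x, ENNReal.ofReal (|info b P x - entropy b P| ^ 3) ∂P

/-- The Berry-Esseen constant `B = C₀ T(X) / V(X)^{3/2}`. -/
def constB (b : ℝ) (P : Measure 𝒳) : ℝ :=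
  C₀ * (thirdMoment b P).toReal / varentropy b P ^ (3 / 2 : ℝ)

/-- `C = 2 (log 2 / √(2 π V(X)) + 2 B)`. -/
def constC (b : ℝ) (P : Measure 𝒳) : ℝ :=
  2 * (Real.logb b 2 / √(2 * Real.pi * varentropy b P) + 2 * constB b P)

/-! ### Source codes -/

/-- There is an `(M, ε)` code for a random variable with law `P` on the alphabet `𝒳`: an encoder
`f : 𝒳 → [M]` and a decoder `g : [M] → 𝒳` with error probability at most `ε`. -/
def ExistsCode (P : Measure 𝒳) (M : ℕ) (ε : ℝ) : Prop :=
  ∃ (f : 𝒳 → Fin M) (g : Fin M → 𝒳), P.real {x | g (f x) ≠ x} ≤ ε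

/-- The law of `Xⁿ = (X₁, …, Xₙ)` for the stationary memoryless source with single-letter
distribution `P`. -/
def blockLaw (P : Measure 𝒳) (n : ℕ) : Measure (Fin n → 𝒳) :=
  Measure.pi (fun _ : Fin n => P)

/-- `M*(n, ε)`, the minimum size of an `(n, M, ε)` code. -/
def minCodeSize (P : Measure 𝒳) (n : ℕ) (ε : ℝ) : ℕ :=
  sInf {M : ℕ | ExistsCode (blockLaw P n) M ε}

/-- `R*(n, ε) = (1 / n) log M*(n, ε)`. -/
def minRate (b : ℝ) (P : Measure 𝒳) (n : ℕ) (ε : ℝ) : ℝ :=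
  1 / (n : ℝ) * Real.logb b (minCodeSize P n ε)

end Info

/-- `u(n) = O(f(n))` in the sense that `0 ≤ u(n) ≤ c f(n)` for all `n > n₀`, for some `c` and `n₀`
in `[0, ∞)`. -/
def IsNonnegBigO (u f : ℕ → ℝ) : Prop :=
  ∃ c n₀ : ℝ, 0 ≤ c ∧ 0 ≤ n₀ ∧ ∀ n : ℕ, n₀ < (n : ℝ) → 0 ≤ u n ∧ u n ≤ c * f n

end SourceCoding

end

namespace SourceCoding

open Set Filter Topology
open scoped NNReal ENNReal

/-! ### The standard Gaussian distribution function -/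

/-! The code lists every block whose information `∑ ı(xᵢ)` is at most a threshold `β`; an error
occurs only outside the list. The information is a sum of i.i.d. variables, so with `β = nH + √(nV)
Q⁻¹(ε - B/√n)` Berry-Esseen keeps the error below `ε`.

A listed block has probability at least `b ^ (-β)`, which alone bounds the list size by `b ^ β`. The
term `-log n / (2n)` comes from a finer count (`card_le_of_subset_lowInfoBlocks`). Cut the
information axis below `β` into windows of length `log 2`. By Berry-Esseen at both ends, a window
carries probability at most `C / (2√n)` (`blockLaw_window_le`), and in the `k`-th window a block has
probability at least `2 ^ k * b ^ (-β)`. Summing the geometric series over `k` leaves at most `C * b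
^ β / √n` blocks. Finally `Q⁻¹(ε - B/√n) - Q⁻¹(ε)` is at most `B/√n` divided by a lower bound for
the Gaussian density between the two quantiles (`minRate_sub_le`); monotonicity of the density on
each half-line supplies that bound.

Since `C₀` is an infimum, Berry-Esseen itself has to be proved with some constant
(`exists_berryEsseen_standardized`). The proof is Lindeberg's replacement after Gaussian smoothing,
by induction on `n`: each swap costs a third derivative averaged over a shorter sum, and the
induction hypothesis compares that sum with its Gaussian counterpart. A smoothing variance
proportional to the squared third moment makes the recursive contribution a contraction. Conversely
`C₀ ≥ 1/4`, whence `C ≥ 1`, so the claimed bounds are nonnegative and the remainder may be truncated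
at zero. -/

lemma gaussDensity_eq (z : ℝ) :
    gaussDensity z = (√(2 * Real.pi))⁻¹ * Real.exp (-z ^ 2 / 2) := by
  simp [gaussDensity, gaussianPDFReal]

lemma gaussDensity_pos (z : ℝ) : 0 < gaussDensity z :=
  gaussianPDFReal_pos 0 1 z one_ne_zero

lemma hasDerivAt_gaussDensity (z : ℝ) : HasDerivAt gaussDensity (-z * gaussDensity z) z := by
  have h : HasDerivAt (fun z : ℝ => (√(2 * Real.pi))⁻¹ * Real.exp (-z ^ 2 / 2))
      ((√(2 * Real.pi))⁻¹ * (Real.exp (-z ^ 2 / 2) * (-(2 * z) / 2))) z := by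
    have h1 : HasDerivAt (fun z : ℝ => -z ^ 2 / 2) (-(2 * z) / 2) z := by
      simpa using ((hasDerivAt_pow 2 z).neg.div_const 2)
    exact (h1.exp).const_mul _
  have e : gaussDensity = fun z : ℝ => (√(2 * Real.pi))⁻¹ * Real.exp (-z ^ 2 / 2) :=
    funext gaussDensity_eq
  rw [e]
  convert h using 1
  ring

lemma continuous_gaussDensity : Continuous gaussDensity :=
  continuous_iff_continuousAt.2 fun z => (hasDerivAt_gaussDensity z).continuousAt

lemma gaussDensity_le_of_sq_le {x y : ℝ} (h : x ^ 2 ≤ y ^ 2) :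
    gaussDensity y ≤ gaussDensity x := by
  rw [gaussDensity_eq, gaussDensity_eq]
  gcongr

lemma gaussDensity_le (z : ℝ) : gaussDensity z ≤ (√(2 * Real.pi))⁻¹ := by
  have := gaussDensity_le_of_sq_le (x := 0) (y := z) (by nlinarith [sq_nonneg z])
  simpa [gaussDensity_eq 0] using this

lemma integrable_gaussDensity : Integrable gaussDensity :=
  integrable_gaussianPDFReal 0 1

lemma Phi_eq_real (z : ℝ) : Phi z = (gaussianReal 0 1).real (Iic z) := cdf_eq_real _ _

lemma Phi_eq_integral (z : ℝ) : Phi z = ∫ x in Iic z, gaussDensity x := by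
  rw [Phi_eq_real, Measure.real, gaussianReal_apply_eq_integral 0 one_ne_zero]
  rw [ENNReal.toReal_ofReal]
  · rfl
  · exact setIntegral_nonneg measurableSet_Iic fun x _ => (gaussDensity_pos x).le

lemma hasDerivAt_Phi (z : ℝ) : HasDerivAt Phi (gaussDensity z) z := by
  have e : Phi = fun z => (∫ x in Iic 0, gaussDensity x) + ∫ x in (0:ℝ)..z, gaussDensity x := by
    funext z
    rw [Phi_eq_integral, ← intervalIntegral.integral_Iic_sub_Iic
      integrable_gaussDensity.integrableOn integrable_gaussDensity.integrableOn]
    ring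
  rw [e]
  refine HasDerivAt.const_add _ ?_
  exact intervalIntegral.integral_hasDerivAt_right
    (integrable_gaussDensity.intervalIntegrable)
    (continuous_gaussDensity.stronglyMeasurableAtFilter _ _) continuous_gaussDensity.continuousAt

lemma continuous_Phi : Continuous Phi :=
  continuous_iff_continuousAt.2 fun z => (hasDerivAt_Phi z).continuousAt

lemma strictMono_Phi : StrictMono Phi :=
  strictMono_of_hasDerivAt_pos hasDerivAt_Phi gaussDensity_pos

lemma Phi_nonneg (z : ℝ) : 0 ≤ Phi z := cdf_nonneg _ z

lemma Phi_le_one (z : ℝ) : Phi z ≤ 1 := cdf_le_one _ z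

lemma abs_Phi_le_one (z : ℝ) : |Phi z| ≤ 1 := abs_le.2 ⟨by linarith [Phi_nonneg z], Phi_le_one z⟩

lemma abs_Phi_sub_Phi_le (x y : ℝ) : |Phi x - Phi y| ≤ (√(2 * Real.pi))⁻¹ * |x - y| := by
  have := Convex.norm_image_sub_le_of_norm_hasDerivWithin_le (f := Phi) (f' := gaussDensity)
    (s := univ) (C := (√(2 * Real.pi))⁻¹) (x := y) (y := x)
    (fun z _ => (hasDerivAt_Phi z).hasDerivWithinAt)
    (fun z _ => by rw [Real.norm_eq_abs, abs_of_pos (gaussDensity_pos z)]; exact gaussDensity_le z)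
    convex_univ (mem_univ _) (mem_univ _)
  simpa using this

/-- The map `x ↦ -√v x` pushes the standard law to variance `v` while exchanging upper and lower
tails, so scaling and symmetry come out together. -/
lemma real_Ici_gaussianReal {v : ℝ≥0} (hv : v ≠ 0) (t : ℝ) :
    (gaussianReal 0 v).real (Ici t) = Phi (-t / √v) := by
  have hs : 0 < √(v : ℝ) := Real.sqrt_pos.2 (by positivity)
  have h := gaussianReal_map_const_mul (μ := 0) (v := 1) (-√(v : ℝ))
  have h2 : gaussianReal 0 v = (gaussianReal 0 1).map (fun x => -√(v : ℝ) * x) := by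
    rw [h]
    congr 1
    · simp
    · ext
      simp
  rw [h2, map_measureReal_apply (by fun_prop) measurableSet_Ici, Phi_eq_real]
  congr 1
  ext x
  simp only [mem_preimage, mem_Ici, mem_Iic]
  rw [le_div_iff₀ hs]
  constructor <;> intro h <;> linarith

lemma Q_eq_Phi_neg (t : ℝ) : Q t = Phi (-t) := by
  have h := real_Ici_gaussianReal (v := 1) one_ne_zero t
  simp only [NNReal.coe_one, Real.sqrt_one, div_one] at h
  rw [← h, Q, Phi_eq_real]
  have := nullSingletonClass_gaussianReal (μ := 0) (v := 1) one_ne_zero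
  rw [← measureReal_congr Ioi_ae_eq_Ici, ← compl_Iic, probReal_compl_eq_one_sub measurableSet_Iic]

/-! ### Higher derivatives of the scaled distribution function -/

/-- The distribution function of the centred Gaussian law with standard deviation `σ`. -/
noncomputable def scaledPhi (σ x : ℝ) : ℝ := Phi (x / σ)

/-- The first derivative of `scaledPhi σ`. -/
noncomputable def scaledPhi₁ (σ x : ℝ) : ℝ := gaussDensity (x / σ) / σ

/-- The second derivative of `scaledPhi σ`. -/
noncomputable def scaledPhi₂ (σ x : ℝ) : ℝ := -(x / σ) * gaussDensity (x / σ) / σ ^ 2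

/-- The third derivative of `scaledPhi σ`. -/
noncomputable def scaledPhi₃ (σ x : ℝ) : ℝ := ((x / σ) ^ 2 - 1) * gaussDensity (x / σ) / σ ^ 3

/-- The fourth derivative of the standard Gaussian distribution function. -/
noncomputable def Phi₄ (x : ℝ) : ℝ := (3 * x - x ^ 3) * gaussDensity x

lemma hasDerivAt_scaledPhi (σ x : ℝ) : HasDerivAt (scaledPhi σ) (scaledPhi₁ σ x) x := by
  have h : HasDerivAt (scaledPhi σ) _ x :=
    (hasDerivAt_Phi (x / σ)).comp x ((hasDerivAt_id x).div_const σ)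
  refine h.congr_deriv ?_
  simp [scaledPhi₁, div_eq_mul_inv]

lemma hasDerivAt_scaledPhi₁ (σ x : ℝ) : HasDerivAt (scaledPhi₁ σ) (scaledPhi₂ σ x) x := by
  have h : HasDerivAt (scaledPhi₁ σ) _ x :=
    ((hasDerivAt_gaussDensity (x / σ)).comp x ((hasDerivAt_id x).div_const σ)).div_const σ
  refine h.congr_deriv ?_
  simp only [scaledPhi₂, div_eq_mul_inv, one_mul]
  ring

lemma hasDerivAt_scaledPhi₂ (σ x : ℝ) : HasDerivAt (scaledPhi₂ σ) (scaledPhi₃ σ x) x := by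
  have h0 := (hasDerivAt_id x).div_const σ
  have h : HasDerivAt (scaledPhi₂ σ) _ x :=
    (((h0.neg).mul ((hasDerivAt_gaussDensity (x / σ)).comp x h0))).div_const (σ ^ 2)
  refine h.congr_deriv ?_
  simp only [scaledPhi₃, div_eq_mul_inv, one_mul, Function.comp, id, Pi.neg_apply]
  ring

lemma hasDerivAt_scaledPhi₃ (σ x : ℝ) :
    HasDerivAt (scaledPhi₃ σ) (Phi₄ (x / σ) / σ ^ 4) x := by
  have h0 := (hasDerivAt_id x).div_const σ
  have h : HasDerivAt (scaledPhi₃ σ) _ x := ((((h0.pow 2).sub_const 1).mul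
    ((hasDerivAt_gaussDensity (x / σ)).comp x h0))).div_const (σ ^ 3)
  refine h.congr_deriv ?_
  simp only [Phi₄, div_eq_mul_inv, one_mul, Function.comp, id, Pi.pow_apply]
  push_cast
  ring

/-- Combines `|x| ^ k ≤ k! * exp |x|` with `|x| - x² / 2 ≤ 1 / 2`. -/
lemma exists_bound_pow_mul_gaussDensity (k : ℕ) :
    ∃ c, 0 ≤ c ∧ ∀ x, |x| ^ k * gaussDensity x ≤ c := by
  have h1 : ∀ x : ℝ, |x| ^ k * gaussDensity x ≤ k.factorial * Real.exp (1 / 2) := by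
    intro x
    have h2 : |x| ^ k / k.factorial ≤ Real.exp |x| := Real.pow_div_factorial_le_exp _ (abs_nonneg x) k
    have hf : (0 : ℝ) < k.factorial := by exact_mod_cast k.factorial_pos
    have hg : gaussDensity x ≤ Real.exp (-x ^ 2 / 2) := by
      rw [gaussDensity_eq]
      have : (√(2 * Real.pi))⁻¹ ≤ 1 := by
        apply inv_le_one_of_one_le₀
        rw [Real.one_le_sqrt]
        linarith [Real.pi_gt_three]
      nlinarith [Real.exp_pos (-x ^ 2 / 2)]
    calc |x| ^ k * gaussDensity x ≤ (k.factorial * Real.exp |x|) * Real.exp (-x ^ 2 / 2) := by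
          gcongr
          · exact (gaussDensity_pos x).le
          · rwa [div_le_iff₀' hf] at h2
      _ = k.factorial * Real.exp (|x| + -x ^ 2 / 2) := by rw [mul_assoc, ← Real.exp_add]
      _ ≤ _ := by
          gcongr
          nlinarith [sq_nonneg (|x| - 1), sq_abs x]
  exact ⟨_, by positivity, h1⟩

lemma exists_bound_scaledPhi_derivs : ∃ c, 0 < c ∧ ∀ σ : ℝ, 0 < σ → ∀ x,
    |scaledPhi₁ σ x| ≤ c / σ ∧ |scaledPhi₂ σ x| ≤ c / σ ^ 2 ∧ |scaledPhi₃ σ x| ≤ c / σ ^ 3 := by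
  obtain ⟨c0, h0, H0⟩ := exists_bound_pow_mul_gaussDensity 0
  obtain ⟨c1, h1, H1⟩ := exists_bound_pow_mul_gaussDensity 1
  obtain ⟨c2, h2, H2⟩ := exists_bound_pow_mul_gaussDensity 2
  refine ⟨c0 + c1 + c2 + 1, by positivity, fun σ hσ x => ?_⟩
  have g := gaussDensity_pos (x / σ)
  specialize H0 (x / σ)
  specialize H1 (x / σ)
  specialize H2 (x / σ)
  simp only [pow_zero, one_mul, pow_one, sq_abs] at H0 H1 H2
  refine ⟨?_, ?_, ?_⟩
  · rw [scaledPhi₁, abs_div, abs_of_pos g, abs_of_pos hσ]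
    gcongr
    linarith
  · rw [scaledPhi₂, abs_div, abs_mul, abs_neg, abs_of_pos g, abs_of_pos (pow_pos hσ 2)]
    gcongr
    linarith
  · rw [scaledPhi₃, abs_div, abs_mul, abs_of_pos g, abs_of_pos (pow_pos hσ 3)]
    gcongr
    have : |(x / σ) ^ 2 - 1| ≤ (x / σ) ^ 2 + 1 := by
      rw [abs_le]
      constructor <;> nlinarith [sq_nonneg (x / σ)]
    nlinarith

lemma continuous_scaledPhi₁ (σ : ℝ) : Continuous (scaledPhi₁ σ) :=
  continuous_iff_continuousAt.2 fun z => (hasDerivAt_scaledPhi₁ σ z).continuousAt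

lemma continuous_scaledPhi₂ (σ : ℝ) : Continuous (scaledPhi₂ σ) :=
  continuous_iff_continuousAt.2 fun z => (hasDerivAt_scaledPhi₂ σ z).continuousAt

lemma continuous_scaledPhi₃ (σ : ℝ) : Continuous (scaledPhi₃ σ) :=
  continuous_iff_continuousAt.2 fun z => (hasDerivAt_scaledPhi₃ σ z).continuousAt

lemma integrable_Phi₄ : Integrable Phi₄ := by
  have e : Phi₄ = fun x => (√(2 * Real.pi))⁻¹ *
      (3 * (x ^ (1 : ℝ) * Real.exp (-(1 / 2) * x ^ 2)) -
        x ^ (3 : ℝ) * Real.exp (-(1 / 2) * x ^ 2)) := by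
    funext x
    rw [Phi₄, gaussDensity_eq, Real.rpow_one, show (3 : ℝ) = ((3 : ℕ) : ℝ) by norm_num,
      Real.rpow_natCast, show -x ^ 2 / 2 = -(1 / 2) * x ^ 2 by ring]
    push_cast
    ring
  rw [e]
  refine Integrable.const_mul (Integrable.sub (Integrable.const_mul ?_ _) ?_) _
  · exact integrable_rpow_mul_exp_neg_mul_sq (by norm_num) (by norm_num)
  · exact integrable_rpow_mul_exp_neg_mul_sq (by norm_num) (by norm_num)

lemma integrable_Phi₄_scaled {σ : ℝ} (hσ : 0 < σ) :
    Integrable (fun x => Phi₄ (x / σ) / σ ^ 4) := by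
  exact (integrable_Phi₄.comp_div hσ.ne').div_const _

lemma integral_abs_Phi₄_scaled {σ : ℝ} (hσ : 0 < σ) :
    ∫ x, |Phi₄ (x / σ) / σ ^ 4| = (∫ x, |Phi₄ x|) / σ ^ 3 := by
  have h := Measure.integral_comp_div (fun x => |Phi₄ x| / σ ^ 4) σ
  simp only [abs_div, abs_of_pos (pow_pos hσ 4)]
  rw [h, integral_div, abs_of_pos hσ, smul_eq_mul]
  field_simp

lemma tendsto_scaledPhi₃_atBot {σ : ℝ} (hσ : 0 < σ) :
    Tendsto (scaledPhi₃ σ) atBot (𝓝 0) := by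
  obtain ⟨c1, h1, H1⟩ := exists_bound_pow_mul_gaussDensity 1
  obtain ⟨c3, h3, H3⟩ := exists_bound_pow_mul_gaussDensity 3
  have key : ∀ w : ℝ, w < 0 → |(w ^ 2 - 1) * gaussDensity w| ≤ (c1 + c3) * |w|⁻¹ := by
    intro w hw
    have hw' : 0 < |w| := abs_pos.2 hw.ne
    rw [abs_mul, abs_of_pos (gaussDensity_pos w), ← div_eq_mul_inv, le_div_iff₀ hw']
    have : |w ^ 2 - 1| ≤ w ^ 2 + 1 := by
      rw [abs_le]
      constructor <;> nlinarith [sq_nonneg w]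
    calc |w ^ 2 - 1| * gaussDensity w * |w| ≤ (w ^ 2 + 1) * gaussDensity w * |w| := by
          gcongr
          exact (gaussDensity_pos w).le
      _ = |w| ^ 1 * gaussDensity w + |w| ^ 3 * gaussDensity w := by
          rw [pow_succ |w| 2, sq_abs]; ring
      _ ≤ _ := add_le_add (H1 w) (H3 w)
  have hlim : Tendsto (fun w : ℝ => (w ^ 2 - 1) * gaussDensity w) atBot (𝓝 0) := by
    refine squeeze_zero_norm' (a := fun w => (c1 + c3) * |w|⁻¹) ?_ ?_
    · filter_upwards [eventually_lt_atBot 0] with w hw using key w hw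
    · simpa using (tendsto_inv_atTop_zero.comp tendsto_abs_atBot_atTop).const_mul (c1 + c3)
  have := (hlim.comp (tendsto_id.atBot_div_const hσ)).div_const (σ ^ 3)
  rw [zero_div] at this
  exact this

/-! ### Tails of convolutions and smoothing -/

lemma conv_real_Ici (ν γ : Measure ℝ) [IsProbabilityMeasure ν] [IsProbabilityMeasure γ] (t : ℝ) :
    (ν ∗ γ).real (Ici t) = ∫ x, γ.real (Ici (t - x)) ∂ν := by
  have hi : Integrable ((Ici t).indicator (1 : ℝ → ℝ)) (ν ∗ γ) :=
    (integrable_const (1 : ℝ)).indicator measurableSet_Ici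
  rw [← integral_indicator_one measurableSet_Ici, integral_conv hi]
  refine integral_congr_ae (Eventually.of_forall fun x => ?_)
  simp only
  rw [← integral_indicator_one measurableSet_Ici]
  refine integral_congr_ae (Eventually.of_forall fun y => ?_)
  simp only [indicator, mem_Ici, sub_le_iff_le_add', Pi.one_apply]

lemma conv_real_Ici' (ν γ : Measure ℝ) [IsProbabilityMeasure ν] [IsProbabilityMeasure γ] (t : ℝ) :
    (ν ∗ γ).real (Ici t) = ∫ z, ν.real (Ici (t - z)) ∂γ := by
  rw [Measure.conv_comm, conv_real_Ici]

lemma antitone_real_Ici (ν : Measure ℝ) [IsProbabilityMeasure ν] :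
    Antitone fun t => ν.real (Ici t) :=
  fun _ _ h => measureReal_mono (Ici_subset_Ici.2 h)

lemma integrable_real_Ici_sub (ν γ : Measure ℝ) [IsProbabilityMeasure ν] [IsProbabilityMeasure γ]
    (t : ℝ) : Integrable (fun z => ν.real (Ici (t - z))) γ := by
  refine Integrable.of_bound (C := 1) ?_ (Eventually.of_forall fun z => ?_)
  · exact ((antitone_real_Ici ν).measurable.comp
      (measurable_const.sub measurable_id)).aestronglyMeasurable
  · rw [Real.norm_eq_abs, abs_of_nonneg measureReal_nonneg]
    exact measureReal_le_one

/-- One-sided smoothing inequality: a lower bound `w` of `u` on `[-r, r]` is controlled by the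
average of `u` over `γ` and the global lower bound `-D`. -/
lemma le_of_integral_le {γ : Measure ℝ} [IsProbabilityMeasure γ] {u : ℝ → ℝ} (hu : Integrable u γ)
    {r D w Δ : ℝ} (hγ : 3 / 4 ≤ γ.real (Icc (-r) r)) (hD : ∀ z, -D ≤ u z)
    (hw : ∀ z ∈ Icc (-r) r, w ≤ u z) (hΔ : ∫ z, u z ∂γ ≤ Δ) (hD0 : 0 ≤ D) (hΔ0 : 0 ≤ Δ) :
    w ≤ 4 / 3 * Δ + D / 3 := by
  by_cases hwD : w + D ≤ 0
  · linarith
  have h1 : Integrable ((Icc (-r) r).indicator fun _ => w + D) γ :=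
    (integrable_const _).indicator measurableSet_Icc
  have h2 : ∫ z, ((Icc (-r) r).indicator (fun _ => w + D) z - D) ∂γ ≤ ∫ z, u z ∂γ := by
    refine integral_mono (h1.sub (integrable_const _)) hu fun z => ?_
    by_cases hz : z ∈ Icc (-r) r
    · simp only [indicator_of_mem hz]
      linarith [hw z hz]
    · simp only [indicator_of_notMem hz]
      linarith [hD z]
  rw [integral_sub h1 (integrable_const _), integral_indicator measurableSet_Icc,
    setIntegral_const, integral_const, probReal_univ, smul_eq_mul, smul_eq_mul] at h2
  nlinarith

/-- Tails are monotone, so a large discrepancy at `t` persists, up to the Lipschitz loss `2 r L`, on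
an interval of length `2r` to one side of `t`. Averaging over `γ` centred on that interval detects
it. The remaining mass of `γ`, at most `1/4`, is controlled by the supremum `D` of the discrepancy,
which is finite and is absorbed from `D ≤ 4/3 Δ + D/3 + 2 r L`. -/
lemma abs_real_Ici_sub_le_of_conv {ν ν' γ : Measure ℝ} [IsProbabilityMeasure ν]
    [IsProbabilityMeasure ν'] [IsProbabilityMeasure γ] {r L Δ : ℝ} (hr : 0 ≤ r) (hL : 0 ≤ L)
    (hγ : 3 / 4 ≤ γ.real (Icc (-r) r))
    (hlip : ∀ s t, |ν'.real (Ici s) - ν'.real (Ici t)| ≤ L * |s - t|)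
    (hΔ : ∀ t, |(ν ∗ γ).real (Ici t) - (ν' ∗ γ).real (Ici t)| ≤ Δ) (t : ℝ) :
    |ν.real (Ici t) - ν'.real (Ici t)| ≤ 2 * Δ + 3 * (r * L) := by
  have hΔ0 : 0 ≤ Δ := (abs_nonneg _).trans (hΔ 0)
  set u : ℝ → ℝ := fun t => ν.real (Ici t) - ν'.real (Ici t) with hu
  have hb : BddAbove (range fun t => |u t|) := by
    refine ⟨1, ?_⟩
    rintro _ ⟨t, rfl⟩
    have h1 : ν.real (Ici t) ≤ 1 := measureReal_le_one
    have h2 : ν'.real (Ici t) ≤ 1 := measureReal_le_one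
    have h3 : 0 ≤ ν.real (Ici t) := measureReal_nonneg
    have h4 : 0 ≤ ν'.real (Ici t) := measureReal_nonneg
    simp only [hu]
    rw [abs_le]
    constructor <;> linarith
  set D := ⨆ t, |u t| with hDdef
  have hD : ∀ t, |u t| ≤ D := fun t => le_ciSup hb t
  have hD0 : 0 ≤ D := (abs_nonneg _).trans (hD 0)
  have hint : ∀ s, Integrable (fun z => u (s - z)) γ := fun s =>
    (integrable_real_Ici_sub ν γ s).sub (integrable_real_Ici_sub ν' γ s)
  have hconv : ∀ s, ∫ z, u (s - z) ∂γ = (ν ∗ γ).real (Ici s) - (ν' ∗ γ).real (Ici s) := by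
    intro s
    rw [conv_real_Ici', conv_real_Ici', ← integral_sub (integrable_real_Ici_sub ν γ s)
      (integrable_real_Ici_sub ν' γ s)]
  have key : ∀ t, |u t| ≤ 4 / 3 * Δ + D / 3 + 2 * (r * L) := by
    intro t
    have hup : u t - 2 * (r * L) ≤ 4 / 3 * Δ + D / 3 := by
      refine le_of_integral_le (hint (t - r)) hγ (fun z => (abs_le.1 (hD _)).1) ?_
        ((hconv (t - r)).le.trans (abs_le.1 (hΔ _)).2) hD0 hΔ0
      intro z hz
      have h1 : ν.real (Ici t) ≤ ν.real (Ici (t - r - z)) :=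
        antitone_real_Ici ν (by linarith [hz.1])
      have h2 := (abs_le.1 (hlip (t - r - z) t)).2
      have h3 : |t - r - z - t| ≤ 2 * r := by
        rw [abs_le]; constructor <;> linarith [hz.1, hz.2]
      have h4 := mul_le_mul_of_nonneg_left h3 hL
      simp only [hu]
      linarith
    have hlo : -u t - 2 * (r * L) ≤ 4 / 3 * Δ + D / 3 := by
      refine le_of_integral_le (u := fun z => -u (t + r - z)) (hint (t + r)).neg hγ
        (fun z => neg_le_neg (abs_le.1 (hD _)).2) ?_ ?_ hD0 hΔ0
      · intro z hz
        have h1 : ν.real (Ici (t + r - z)) ≤ ν.real (Ici t) :=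
          antitone_real_Ici ν (by linarith [hz.2])
        have h2 := (abs_le.1 (hlip (t + r - z) t)).1
        have h3 : |t + r - z - t| ≤ 2 * r := by
          rw [abs_le]; constructor <;> linarith [hz.1, hz.2]
        have h4 := mul_le_mul_of_nonneg_left h3 hL
        simp only [hu]
        linarith
      · rw [integral_neg, hconv]
        linarith [(abs_le.1 (hΔ (t + r))).1]
    rw [abs_le]
    constructor <;> linarith
  have hDle : D ≤ 4 / 3 * Δ + D / 3 + 2 * (r * L) := ciSup_le key
  exact (hD t).trans (by linarith)

/-! ### Averages of translates -/

lemma integrable_translate {f : ℝ → ℝ} (hf : Continuous f) {c : ℝ} (hc : ∀ x, |f x| ≤ c)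
    (ν : Measure ℝ) [IsProbabilityMeasure ν] (a : ℝ) : Integrable (fun x => f (x + a)) ν :=
  Integrable.of_bound (C := c) (hf.comp (continuous_id.add continuous_const)).aestronglyMeasurable
    (Eventually.of_forall fun _ => hc _)

lemma hasDerivAt_integral_translate {f f' : ℝ → ℝ} (hf : ∀ x, HasDerivAt f (f' x) x)
    (hf' : Continuous f') {c c' : ℝ} (hc : ∀ x, |f x| ≤ c) (hc' : ∀ x, |f' x| ≤ c')
    (ν : Measure ℝ) [IsProbabilityMeasure ν] (a : ℝ) :
    HasDerivAt (fun a => ∫ x, f (x + a) ∂ν) (∫ x, f' (x + a) ∂ν) a := by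
  have hcont : Continuous f := continuous_iff_continuousAt.2 fun z => (hf z).continuousAt
  refine (hasDerivAt_integral_of_dominated_loc_of_deriv_le (F := fun a x => f (x + a))
    (F' := fun a x => f' (x + a)) (bound := fun _ => c') (s := univ) univ_mem
    (Eventually.of_forall fun b => (integrable_translate hcont hc ν b).aestronglyMeasurable)
    (integrable_translate hcont hc ν a) (integrable_translate hf' hc' ν a).aestronglyMeasurable
    (Eventually.of_forall fun _ _ _ => hc' _) (integrable_const _)
    (Eventually.of_forall fun _ _ _ => (hf _).comp_const_add _ _)).2

/-- Integration by parts through Fubini: the mean of `f` depends on the law only through its tails,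
so two laws with uniformly close tails give means that differ by at most that distance times the
`L¹` norm of `f'`. -/
lemma integral_translate_eq {f f' : ℝ → ℝ} (hf : ∀ x, HasDerivAt f (f' x) x)
    (hf' : Integrable f') (hlim : Tendsto f atBot (𝓝 0)) (ν : Measure ℝ) [IsProbabilityMeasure ν]
    (a : ℝ) : ∫ x, f (x + a) ∂ν = ∫ u, f' u * ν.real (Ici (u - a)) := by
  have h1 : ∀ v, f v = ∫ u in Iic v, f' u := fun v => by
    rw [integral_Iic_of_hasDerivAt_of_tendsto' (fun x _ => hf x) hf'.integrableOn hlim, sub_zero]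
  have hmeas : MeasurableSet {p : ℝ × ℝ | p.2 ≤ p.1 + a} :=
    measurableSet_le measurable_snd (measurable_fst.add_const a)
  have hint : Integrable (Function.uncurry fun x u => (Iic (x + a)).indicator f' u)
      (ν.prod volume) := by
    have := (hf'.comp_snd ν).indicator hmeas
    refine this.congr (Eventually.of_forall fun p => ?_)
    simp [Function.uncurry, indicator]
  calc ∫ x, f (x + a) ∂ν = ∫ x, (∫ u, (Iic (x + a)).indicator f' u) ∂ν := by
        refine integral_congr_ae (Eventually.of_forall fun x => ?_)
        simp only
        rw [h1, integral_indicator measurableSet_Iic]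
    _ = ∫ u, ∫ x, (Iic (x + a)).indicator f' u ∂ν := integral_integral_swap hint
    _ = _ := by
        refine integral_congr_ae (Eventually.of_forall fun u => ?_)
        simp only
        rw [← integral_indicator_one measurableSet_Ici, ← integral_const_mul]
        refine integral_congr_ae (Eventually.of_forall fun x => ?_)
        simp only [indicator, mem_Ici, mem_Iic, sub_le_iff_le_add, Pi.one_apply, mul_ite, mul_one,
          mul_zero]

lemma abs_integral_translate_sub_le {f f' : ℝ → ℝ} (hf : ∀ x, HasDerivAt f (f' x) x)
    (hf' : Integrable f') (hlim : Tendsto f atBot (𝓝 0)) {ν ν' : Measure ℝ}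
    [IsProbabilityMeasure ν] [IsProbabilityMeasure ν'] {D : ℝ}
    (hD : ∀ t, |ν.real (Ici t) - ν'.real (Ici t)| ≤ D) (a : ℝ) :
    |∫ x, f (x + a) ∂ν - ∫ x, f (x + a) ∂ν'| ≤ D * ∫ u, |f' u| := by
  have hI : ∀ (ν : Measure ℝ) [IsProbabilityMeasure ν],
      Integrable fun u => f' u * ν.real (Ici (u - a)) := by
    intro ν _
    refine hf'.mul_bdd (c := 1) ?_ (Eventually.of_forall fun u => ?_)
    · exact ((antitone_real_Ici ν).measurable.comp (measurable_id.sub_const a)).aestronglyMeasurable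
    · rw [Real.norm_eq_abs, abs_of_nonneg measureReal_nonneg]
      exact measureReal_le_one
  rw [integral_translate_eq hf hf' hlim ν, integral_translate_eq hf hf' hlim ν',
    ← integral_sub (hI ν) (hI ν'), ← integral_const_mul]
  refine (abs_integral_le_integral_abs).trans
    (integral_mono ((hI ν).sub (hI ν')).abs (hf'.abs.const_mul D) fun u => ?_)
  simp only
  rw [← mul_sub, abs_mul, mul_comm]
  gcongr
  exact hD _

/-! ### Replacing one summand -/

lemma abs_le_of_hasDerivAt_le {g g' : ℝ → ℝ} (hg : ∀ x, HasDerivAt g (g' x) x) (h0 : g 0 = 0)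
    {M : ℝ} {k : ℕ} (hM : 0 ≤ M) (hb : ∀ x, |g' x| ≤ M * |x| ^ k) (y : ℝ) :
    |g y| ≤ M * |y| ^ (k + 1) := by
  have := Convex.norm_image_sub_le_of_norm_hasDerivWithin_le (f := g) (f' := g')
    (s := Icc (-|y|) |y|) (C := M * |y| ^ k) (x := 0) (y := y)
    (fun z _ => (hg z).hasDerivWithinAt) (fun z hz => ?_) (convex_Icc _ _)
    (by simp) ⟨neg_abs_le y, le_abs_self y⟩
  · rw [h0, sub_zero, sub_zero, Real.norm_eq_abs, Real.norm_eq_abs] at this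
    rw [pow_succ, ← mul_assoc]
    exact this
  · refine (hb z).trans ?_
    have : |z| ≤ |y| := abs_le.2 hz
    gcongr

lemma abs_taylor_two_le {h h₁ h₂ h₃ : ℝ → ℝ} (d1 : ∀ x, HasDerivAt h (h₁ x) x)
    (d2 : ∀ x, HasDerivAt h₁ (h₂ x) x) (d3 : ∀ x, HasDerivAt h₂ (h₃ x) x) {M : ℝ}
    (hM : ∀ x, |h₃ x| ≤ M) (y : ℝ) :
    |h y - (h 0 + h₁ 0 * y + h₂ 0 / 2 * y ^ 2)| ≤ M * |y| ^ 3 := by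
  have hM0 : 0 ≤ M := (abs_nonneg _).trans (hM 0)
  have e2 : ∀ y, |h₂ y - h₂ 0| ≤ M * |y| ^ 1 :=
    abs_le_of_hasDerivAt_le (fun x => (d3 x).sub_const (h₂ 0)) (by simp) hM0 (by simpa using hM)
  have e1 : ∀ y, |h₁ y - (h₁ 0 + h₂ 0 * y)| ≤ M * |y| ^ 2 := by
    refine abs_le_of_hasDerivAt_le (g' := fun y => h₂ y - h₂ 0) (fun x => ?_) (by simp) hM0 e2
    have : HasDerivAt (fun y => h₁ 0 + h₂ 0 * y) (h₂ 0) x := by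
      simpa using ((hasDerivAt_id x).const_mul (h₂ 0)).const_add (h₁ 0)
    exact (d2 x).sub this
  refine abs_le_of_hasDerivAt_le (g := fun y => h y - (h 0 + h₁ 0 * y + h₂ 0 / 2 * y ^ 2))
    (g' := fun y => h₁ y - (h₁ 0 + h₂ 0 * y)) (fun x => ?_) (by simp) hM0 e1 y
  have : HasDerivAt (fun y => h 0 + h₁ 0 * y + h₂ 0 / 2 * y ^ 2) (h₁ 0 + h₂ 0 * x) x := by
    have a1 := ((hasDerivAt_id x).const_mul (h₁ 0)).const_add (h 0)
    have a2 := (hasDerivAt_pow 2 x).const_mul (h₂ 0 / 2)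
    refine (a1.add a2).congr_deriv ?_
    push_cast
    ring
  exact (d1 x).sub this

/-- Equal first and second moments cancel the quadratic Taylor polynomials at `0`, leaving only the
two cubic remainders. -/
lemma abs_integral_sub_integral_le {h h₁ h₂ h₃ : ℝ → ℝ} (d1 : ∀ x, HasDerivAt h (h₁ x) x)
    (d2 : ∀ x, HasDerivAt h₁ (h₂ x) x) (d3 : ∀ x, HasDerivAt h₂ (h₃ x) x) {M : ℝ}
    (hM : ∀ x, |h₃ x| ≤ M) {μ γ : Measure ℝ} [IsProbabilityMeasure μ] [IsProbabilityMeasure γ]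
    (hμ : MemLp id 3 μ) (hγ : MemLp id 3 γ) (hhμ : Integrable h μ) (hhγ : Integrable h γ)
    (e1 : ∫ x, x ∂μ = ∫ x, x ∂γ) (e2 : ∫ x, x ^ 2 ∂μ = ∫ x, x ^ 2 ∂γ) :
    |∫ x, h x ∂μ - ∫ x, h x ∂γ| ≤ M * (∫ x, |x| ^ 3 ∂μ + ∫ x, |x| ^ 3 ∂γ) := by
  have main : ∀ (μ : Measure ℝ) [IsProbabilityMeasure μ], MemLp id 3 μ → Integrable h μ →
      |∫ x, h x ∂μ - (h 0 + h₁ 0 * ∫ x, x ∂μ + h₂ 0 / 2 * ∫ x, x ^ 2 ∂μ)|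
        ≤ M * ∫ x, |x| ^ 3 ∂μ := by
    intro μ _ hμ hh
    have i1 : Integrable (fun x : ℝ => x) μ := hμ.integrable (by norm_num)
    have i2 : Integrable (fun x : ℝ => x ^ 2) μ :=
      (hμ.mono_exponent (p := 2) (by norm_num)).integrable_sq
    have i3 : Integrable (fun x : ℝ => |x| ^ 3) μ := by
      simpa using hμ.integrable_norm_pow (p := 3) (by norm_num)
    have ip : Integrable (fun x => h 0 + h₁ 0 * x + h₂ 0 / 2 * x ^ 2) μ :=
      ((integrable_const _).add (i1.const_mul _)).add (i2.const_mul _)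
    have : h 0 + h₁ 0 * ∫ x, x ∂μ + h₂ 0 / 2 * ∫ x, x ^ 2 ∂μ
        = ∫ x, (h 0 + h₁ 0 * x + h₂ 0 / 2 * x ^ 2) ∂μ := by
      have i4 : Integrable (fun x => h 0 + h₁ 0 * x) μ := (integrable_const _).add (i1.const_mul _)
      rw [integral_add i4 (i2.const_mul _), integral_add (integrable_const _) (i1.const_mul _),
        integral_const_mul, integral_const_mul]
      simp
    rw [this, ← integral_sub hh ip, ← integral_const_mul]
    exact abs_integral_le_integral_abs.trans (integral_mono (hh.sub ip).abs (i3.const_mul M)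
      fun y => abs_taylor_two_le d1 d2 d3 hM y)
  have a := abs_le.1 (main μ hμ hhμ)
  have b := abs_le.1 (main γ hγ hhγ)
  rw [e1, e2] at a
  rw [abs_le]
  constructor <;> linarith [a.1, a.2, b.1, b.2]

/-- Gaussian smoothing turns a tail probability into the mean of a smooth function, to which Taylor
expansion applies. -/
lemma conv_gaussianReal_real_Ici (ν : Measure ℝ) [IsProbabilityMeasure ν] {s : ℝ≥0} (hs : s ≠ 0)
    (t : ℝ) : (ν ∗ gaussianReal 0 s).real (Ici t) = ∫ x, scaledPhi (√s) (x + -t) ∂ν := by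
  rw [conv_real_Ici]
  refine integral_congr_ae (Eventually.of_forall fun x => ?_)
  simp only
  rw [real_Ici_gaussianReal hs, scaledPhi]
  congr 2
  ring

lemma sqrt_nnreal_pos {s : ℝ≥0} (hs : s ≠ 0) : 0 < √(s : ℝ) := Real.sqrt_pos.2 (by positivity)

lemma abs_scaledPhi_le (σ x : ℝ) : |scaledPhi σ x| ≤ 1 := abs_Phi_le_one _

lemma hasDerivAt_integral_scaledPhi (ν : Measure ℝ) [IsProbabilityMeasure ν] {σ : ℝ} (hσ : 0 < σ)
    (a : ℝ) :
    HasDerivAt (fun a => ∫ x, scaledPhi σ (x + a) ∂ν) (∫ x, scaledPhi₁ σ (x + a) ∂ν) a := by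
  obtain ⟨c, -, hc⟩ := exists_bound_scaledPhi_derivs
  exact hasDerivAt_integral_translate (hasDerivAt_scaledPhi σ) (continuous_scaledPhi₁ σ)
    (abs_scaledPhi_le σ) (fun x => (hc σ hσ x).1) ν a

lemma hasDerivAt_integral_scaledPhi₁ (ν : Measure ℝ) [IsProbabilityMeasure ν] {σ : ℝ} (hσ : 0 < σ)
    (a : ℝ) :
    HasDerivAt (fun a => ∫ x, scaledPhi₁ σ (x + a) ∂ν) (∫ x, scaledPhi₂ σ (x + a) ∂ν) a := by
  obtain ⟨c, -, hc⟩ := exists_bound_scaledPhi_derivs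
  exact hasDerivAt_integral_translate (hasDerivAt_scaledPhi₁ σ) (continuous_scaledPhi₂ σ)
    (fun x => (hc σ hσ x).1) (fun x => (hc σ hσ x).2.1) ν a

lemma hasDerivAt_integral_scaledPhi₂ (ν : Measure ℝ) [IsProbabilityMeasure ν] {σ : ℝ} (hσ : 0 < σ)
    (a : ℝ) :
    HasDerivAt (fun a => ∫ x, scaledPhi₂ σ (x + a) ∂ν) (∫ x, scaledPhi₃ σ (x + a) ∂ν) a := by
  obtain ⟨c, -, hc⟩ := exists_bound_scaledPhi_derivs
  exact hasDerivAt_integral_translate (hasDerivAt_scaledPhi₂ σ) (continuous_scaledPhi₃ σ)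
    (fun x => (hc σ hσ x).2.1) (fun x => (hc σ hσ x).2.2) ν a

lemma integral_scaledPhi_gaussianReal (v : ℝ≥0) {s : ℝ≥0} (hs : s ≠ 0) (a : ℝ) :
    ∫ x, scaledPhi (√s) (x + a) ∂(gaussianReal 0 v) = scaledPhi (√(v + s)) a := by
  have h := conv_gaussianReal_real_Ici (gaussianReal 0 v) hs (-a)
  rw [neg_neg] at h
  rw [← h, gaussianReal_conv_gaussianReal, add_zero, real_Ici_gaussianReal (by positivity),
    scaledPhi, neg_neg, NNReal.coe_add]

/-- Variances add under convolution, which gives the identity for `scaledPhi`; uniqueness of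
derivatives carries it through three differentiations in `a`. -/
lemma integral_scaledPhi₃_gaussianReal (v : ℝ≥0) {s : ℝ≥0} (hs : s ≠ 0) (a : ℝ) :
    ∫ x, scaledPhi₃ (√s) (x + a) ∂(gaussianReal 0 v) = scaledPhi₃ (√(v + s)) a := by
  have hσ := sqrt_nnreal_pos hs
  have e0 : (fun a => ∫ x, scaledPhi (√s) (x + a) ∂(gaussianReal 0 v)) = scaledPhi (√(v + s)) :=
    funext (integral_scaledPhi_gaussianReal v hs)
  have e1 : (fun a => ∫ x, scaledPhi₁ (√s) (x + a) ∂(gaussianReal 0 v)) = scaledPhi₁ (√(v + s)) :=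
    funext fun a => (e0 ▸ hasDerivAt_integral_scaledPhi (gaussianReal 0 v) hσ a).unique
      (hasDerivAt_scaledPhi _ a)
  have e2 : (fun a => ∫ x, scaledPhi₂ (√s) (x + a) ∂(gaussianReal 0 v)) = scaledPhi₂ (√(v + s)) :=
    funext fun a => (e1 ▸ hasDerivAt_integral_scaledPhi₁ (gaussianReal 0 v) hσ a).unique
      (hasDerivAt_scaledPhi₁ _ a)
  exact (e2 ▸ hasDerivAt_integral_scaledPhi₂ (gaussianReal 0 v) hσ a).unique
    (hasDerivAt_scaledPhi₂ _ a)

/-- Cost of replacing one summand by a Gaussian one, in the presence of a further Gaussian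
summand of variance `s`. -/
lemma exists_swap_bound : ∃ c, 0 < c ∧ ∀ (μ ν : Measure ℝ) [IsProbabilityMeasure μ]
    [IsProbabilityMeasure ν], MemLp id 3 μ → ∫ x, x ∂μ = 0 → ∫ x, x ^ 2 ∂μ = 1 →
    ∀ (v s : ℝ≥0), s ≠ 0 → ∀ D : ℝ,
    (∀ t, |ν.real (Ici t) - (gaussianReal 0 v).real (Ici t)| ≤ D) → ∀ t,
    |((ν ∗ μ) ∗ gaussianReal 0 s).real (Ici t) - (ν ∗ gaussianReal 0 (1 + s)).real (Ici t)|
      ≤ c * (1 / √(v + s) ^ 3 + D / √s ^ 3) * (∫ x, |x| ^ 3 ∂μ + 1) := by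
  obtain ⟨c, hc0, hc⟩ := exists_bound_scaledPhi_derivs
  set c4 := ∫ x, |Phi₄ x|
  have hc4 : 0 ≤ c4 := integral_nonneg fun x => abs_nonneg _
  set m := ∫ x, |x| ^ 3 ∂(gaussianReal 0 1)
  have hm : 0 ≤ m := integral_nonneg fun x => by positivity
  refine ⟨(c + c4) * (1 + m), by positivity, ?_⟩
  intro μ ν _ _ hμ e1 e2 v s hs D hD t
  have hσ := sqrt_nnreal_pos hs
  have hτ : 0 < √((v : ℝ) + s) := Real.sqrt_pos.2 (by positivity)
  have hD0 : 0 ≤ D := (abs_nonneg _).trans (hD 0)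
  have hρ : 0 ≤ ∫ x, |x| ^ 3 ∂μ := integral_nonneg fun x => by positivity
  -- Replacing `ν` by the Gaussian law of variance `v` gives the first term, a third derivative at
  -- the larger scale `√(v + s)`. The replacement costs `D` times the `L¹` norm of the fourth
  -- derivative, of order `s ^ (-3/2)`.
  have hb : ∀ a, |∫ x, scaledPhi₃ (√s) (x + a) ∂ν|
      ≤ c / √((v : ℝ) + s) ^ 3 + D * (c4 / √s ^ 3) := by
    intro a
    have h1 := abs_integral_translate_sub_le (hasDerivAt_scaledPhi₃ (√s))
      (integrable_Phi₄_scaled hσ) (tendsto_scaledPhi₃_atBot hσ) hD a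
    rw [integral_scaledPhi₃_gaussianReal v hs, integral_abs_Phi₄_scaled hσ] at h1
    have h2 := (hc _ hτ a).2.2
    rw [abs_le] at *
    constructor <;> linarith [h1.1, h1.2, h2.1, h2.2]
  set h : ℝ → ℝ := fun y => ∫ x, scaledPhi (√s) (x + (y + -t)) ∂ν with hh
  have d1 : ∀ y, HasDerivAt h (∫ x, scaledPhi₁ (√s) (x + (y + -t)) ∂ν) y := fun y =>
    (hasDerivAt_integral_scaledPhi ν hσ (y + -t)).comp_add_const y (-t)
  have d2 : ∀ y, HasDerivAt (fun y => ∫ x, scaledPhi₁ (√s) (x + (y + -t)) ∂ν)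
      (∫ x, scaledPhi₂ (√s) (x + (y + -t)) ∂ν) y := fun y =>
    (hasDerivAt_integral_scaledPhi₁ ν hσ (y + -t)).comp_add_const y (-t)
  have d3 : ∀ y, HasDerivAt (fun y => ∫ x, scaledPhi₂ (√s) (x + (y + -t)) ∂ν)
      (∫ x, scaledPhi₃ (√s) (x + (y + -t)) ∂ν) y := fun y =>
    (hasDerivAt_integral_scaledPhi₂ ν hσ (y + -t)).comp_add_const y (-t)
  have hval : ∀ y, (ν ∗ gaussianReal 0 s).real (Ici (t - y)) = h y := by
    intro y
    rw [conv_gaussianReal_real_Ici ν hs]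
    simp only [hh, show -(t - y) = y + -t by ring]
  have hint : ∀ (μ : Measure ℝ) [IsProbabilityMeasure μ], Integrable h μ := by
    intro μ _
    refine (integrable_real_Ici_sub (ν ∗ gaussianReal 0 s) μ t).congr
      (Eventually.of_forall hval)
  have hconv : ∀ (μ : Measure ℝ) [IsProbabilityMeasure μ],
      ((ν ∗ μ) ∗ gaussianReal 0 s).real (Ici t) = ∫ y, h y ∂μ := by
    intro μ _
    -- Reordering makes the swapped summand the outermost average, so both laws integrate the same
    -- test function `h`.
    rw [Measure.conv_assoc, Measure.conv_comm μ, ← Measure.conv_assoc, conv_real_Ici']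
    exact integral_congr_ae (Eventually.of_forall hval)
  have hg2 : ∫ x, x ^ 2 ∂(gaussianReal 0 1) = 1 := by
    have := variance_id_gaussianReal (μ := 0) (v := 1)
    rw [variance_of_integral_eq_zero (X := id) (by fun_prop)
      integral_id_gaussianReal] at this
    exact this
  have hmain := abs_integral_sub_integral_le d1 d2 d3 (fun y => hb _) hμ
    (memLp_id_gaussianReal' (μ := 0) (v := 1) 3 (by norm_num)) (hint μ) (hint _)
    (by rw [e1, integral_id_gaussianReal]) (by rw [e2, hg2])
  rw [← hconv, ← hconv, Measure.conv_assoc, Measure.conv_assoc, gaussianReal_conv_gaussianReal,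
    add_zero, ← Measure.conv_assoc] at hmain
  refine hmain.trans ?_
  have a1 : c / √((v : ℝ) + s) ^ 3 + D * (c4 / √s ^ 3)
      ≤ (c + c4) * (1 / √((v : ℝ) + s) ^ 3 + D / √s ^ 3) := by
    have : 0 ≤ c4 * (1 / √((v : ℝ) + s) ^ 3) := by positivity
    have : 0 ≤ c * (D / √s ^ 3) := by positivity
    have : (c + c4) * (1 / √((v : ℝ) + s) ^ 3 + D / √s ^ 3) = c / √((v : ℝ) + s) ^ 3 +
      D * (c4 / √s ^ 3) + c4 * (1 / √((v : ℝ) + s) ^ 3) + c * (D / √s ^ 3) := by ring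
    linarith
  have a2 : ∫ x, |x| ^ 3 ∂μ + m ≤ (1 + m) * (∫ x, |x| ^ 3 ∂μ + 1) := by
    nlinarith [mul_nonneg hm hρ]
  calc _ ≤ ((c + c4) * (1 / √((v : ℝ) + s) ^ 3 + D / √s ^ 3)) *
        ((1 + m) * (∫ x, |x| ^ 3 ∂μ + 1)) := by gcongr
    _ = _ := by ring

/-! ### The Berry-Esseen theorem -/

/-- The `k`-fold convolution power of a measure. -/
noncomputable def convPow (μ : Measure ℝ) : ℕ → Measure ℝ
  | 0 => Measure.dirac 0
  | k + 1 => convPow μ k ∗ μ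

instance isProbabilityMeasure_convPow (μ : Measure ℝ) [IsProbabilityMeasure μ] (k : ℕ) :
    IsProbabilityMeasure (convPow μ k) := by
  induction k with
  | zero => exact Measure.dirac.isProbabilityMeasure
  | succ k ih => rw [convPow]; infer_instance

lemma one_le_integral_abs_pow_three {μ : Measure ℝ} [IsProbabilityMeasure μ] (hμ : MemLp id 3 μ)
    (h2 : ∫ x, x ^ 2 ∂μ = 1) : 1 ≤ ∫ x, |x| ^ 3 ∂μ := by
  have i2 : Integrable (fun x : ℝ => x ^ 2) μ :=
    (hμ.mono_exponent (p := 2) (by norm_num)).integrable_sq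
  have i3 : Integrable (fun x : ℝ => |x| ^ 3) μ := by
    simpa using hμ.integrable_norm_pow (p := 3) (by norm_num)
  -- Pointwise `3x² ≤ 1 + 2|x|³`, since the difference is `(|x| - 1)² (2|x| + 1)`.
  have h := integral_mono (i2.const_mul 3) ((integrable_const 1).add (i3.const_mul 2))
    (fun x => by
      simp only [Pi.add_apply]
      rw [← sq_abs]
      nlinarith [mul_nonneg (sq_nonneg (|x| - 1)) (by positivity : 0 ≤ 2 * |x| + 1)])
  rw [integral_add' (integrable_const 1) (i3.const_mul 2), integral_const_mul, integral_const_mul,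
    h2] at h
  simp at h
  linarith

lemma three_quarters_le_gaussianReal {w : ℝ≥0} (hw : w ≠ 0) :
    3 / 4 ≤ (gaussianReal 0 w).real (Icc (-(2 * √w)) (2 * √w)) := by
  have hpos := sqrt_nnreal_pos hw
  have h := meas_ge_le_variance_div_sq (memLp_id_gaussianReal (μ := 0) (v := w) 2)
    (c := 2 * √w) (by positivity)
  rw [variance_id_gaussianReal, mul_pow, Real.sq_sqrt w.coe_nonneg] at h
  simp only [id, integral_id_gaussianReal, sub_zero] at h
  have hw' : (0 : ℝ) < w := by positivity
  have e : (w : ℝ) / (2 ^ 2 * w) = 1 / 4 := by field_simp; norm_num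
  rw [e] at h
  have h2 : (gaussianReal 0 w).real {x | 2 * √w ≤ |x|} ≤ 1 / 4 := by
    rw [Measure.real]
    exact ENNReal.toReal_le_of_le_ofReal (by norm_num) h
  have h3 : (gaussianReal 0 w).real (Icc (-(2 * √w)) (2 * √w))ᶜ ≤ 1 / 4 := by
    refine (measureReal_mono ?_).trans h2
    intro x hx
    simp only [mem_compl_iff, mem_Icc, ← abs_le, not_le] at hx
    exact hx.le
  rw [probReal_compl_eq_one_sub measurableSet_Icc] at h3
  linarith

/-- A telescoping majorant. With `a = √x`, `b = √(x + 1)` the factor `4` comes from `b (a + b) ≤ 4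
a²`, valid because `b² = a² + 1 ≤ 2 a²`. -/
lemma inv_sqrt_pow_three_le {x : ℝ} (hx : 1 ≤ x) :
    1 / √x ^ 3 ≤ 4 * (1 / √x - 1 / √(x + 1)) := by
  have ha : 0 < √x := Real.sqrt_pos.2 (by linarith)
  have hb : 0 < √(x + 1) := Real.sqrt_pos.2 (by linarith)
  have ha2 : √x ^ 2 = x := Real.sq_sqrt (by linarith)
  have hb2 : √(x + 1) ^ 2 = x + 1 := Real.sq_sqrt (by linarith)
  generalize √x = a at *
  generalize √(x + 1) = b at *
  have e : 1 / a - 1 / b = 1 / (a * b * (a + b)) := by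
    field_simp
    nlinarith
  rw [e, mul_one_div, div_le_div_iff₀ (by positivity) (by positivity)]
  have : b * (a + b) ≤ 4 * a ^ 2 := by nlinarith [sq_nonneg (a - b)]
  nlinarith

lemma sum_inv_sqrt_pow_three_le {w : ℝ} (hw : 1 ≤ w) (n : ℕ) :
    ∑ j ∈ Finset.range n, 1 / √((j : ℝ) + w) ^ 3 ≤ 4 / √w := by
  have h : ∑ j ∈ Finset.range n, 1 / √((j : ℝ) + w) ^ 3
      ≤ ∑ j ∈ Finset.range n, (4 / √((j : ℝ) + w) - 4 / √(((j + 1 : ℕ) : ℝ) + w)) := by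
    refine Finset.sum_le_sum fun j _ => ?_
    have hj : (0 : ℝ) ≤ j := j.cast_nonneg
    refine (inv_sqrt_pow_three_le (by linarith)).trans (le_of_eq ?_)
    rw [show ((j + 1 : ℕ) : ℝ) + w = (j : ℝ) + w + 1 by push_cast; ring]
    ring
  rw [Finset.sum_range_sub' (fun j : ℕ => 4 / √((j : ℝ) + w))] at h
  have : 0 ≤ 4 / √((n : ℝ) + w) := by positivity
  simp only [Nat.cast_zero, zero_add] at h
  linarith

lemma abs_gaussianReal_Ici_sub_le {n : ℕ} (hn : 1 ≤ n) (s t : ℝ) :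
    |(gaussianReal 0 (n : ℝ≥0)).real (Ici s) - (gaussianReal 0 (n : ℝ≥0)).real (Ici t)|
      ≤ 1 / √(n : ℝ) * |s - t| := by
  have hn' : (n : ℝ≥0) ≠ 0 := by exact_mod_cast (by lia : n ≠ 0)
  rw [real_Ici_gaussianReal hn', real_Ici_gaussianReal hn']
  refine (abs_Phi_sub_Phi_le _ _).trans ?_
  have h1 : (√(2 * Real.pi))⁻¹ ≤ 1 := by
    apply inv_le_one_of_one_le₀
    rw [Real.one_le_sqrt]
    linarith [Real.pi_gt_three]
  simp only [NNReal.coe_natCast]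
  rw [← sub_div, abs_div, abs_of_nonneg (Real.sqrt_nonneg _),
    show -s - -t = -(s - t) by ring, abs_neg]
  calc (√(2 * Real.pi))⁻¹ * (|s - t| / √(n : ℝ)) ≤ 1 * (|s - t| / √(n : ℝ)) := by gcongr
    _ = _ := by ring

lemma abs_real_sub_real_le_one (ν ν' : Measure ℝ) [IsProbabilityMeasure ν]
    [IsProbabilityMeasure ν'] (s : Set ℝ) : |ν.real s - ν'.real s| ≤ 1 := by
  have h1 : ν.real s ≤ 1 := measureReal_le_one
  have h2 : ν'.real s ≤ 1 := measureReal_le_one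
  have h3 : 0 ≤ ν.real s := measureReal_nonneg
  have h4 : 0 ≤ ν'.real s := measureReal_nonneg
  rw [abs_le]
  constructor <;> linarith

/-- Lindeberg's replacement argument for the smoothed law of the sum. -/
lemma exists_lindeberg_bound : ∃ c, 0 < c ∧ ∀ (μ : Measure ℝ) [IsProbabilityMeasure μ],
    MemLp id 3 μ → ∫ x, x ∂μ = 0 → ∫ x, x ^ 2 ∂μ = 1 →
    ∀ (n : ℕ) (w : ℝ≥0), w ≠ 0 → ∀ D : ℕ → ℝ,
    (∀ k < n, ∀ t,
      |(convPow μ k).real (Ici t) - (gaussianReal 0 (k : ℝ≥0)).real (Ici t)| ≤ D k) → ∀ t,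
    |(convPow μ n ∗ gaussianReal 0 w).real (Ici t)
        - (gaussianReal 0 (n : ℝ≥0) ∗ gaussianReal 0 w).real (Ici t)|
      ≤ ∑ k ∈ Finset.range n, c * (1 / √((k : ℝ) + ((n - 1 - k : ℕ) + w)) ^ 3
          + D k / √(((n - 1 - k : ℕ) : ℝ) + w) ^ 3) * (∫ x, |x| ^ 3 ∂μ + 1) := by
  obtain ⟨c, hc, H⟩ := exists_swap_bound
  refine ⟨c, hc, ?_⟩
  intro μ _ hμ e1 e2 n w hw D hD t
  -- The hybrids: `k` original summands, `n - k` Gaussian ones of unit variance, and the smoothing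
  -- variance `w`. Consecutive hybrids differ in one summand.
  set A : ℕ → ℝ := fun k => (convPow μ k ∗ gaussianReal 0 ((n - k : ℕ) + w)).real (Ici t) with hA
  have hAn : (convPow μ n ∗ gaussianReal 0 w).real (Ici t) = A n := by simp [hA]
  have hA0 : (gaussianReal 0 (n : ℝ≥0) ∗ gaussianReal 0 w).real (Ici t) = A 0 := by
    simp only [hA, convPow, Measure.dirac_zero_conv]
    rw [gaussianReal_conv_gaussianReal]
    simp
  rw [hAn, hA0, ← Finset.sum_range_sub]
  refine (Finset.abs_sum_le_sum_abs _ _).trans (Finset.sum_le_sum fun k hk => ?_)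
  have hk' := Finset.mem_range.1 hk
  have h := H μ (convPow μ k) hμ e1 e2 k ((n - 1 - k : ℕ) + w) (by positivity) (D k) (hD k hk') t
  have e : (1 : ℝ≥0) + (((n - 1 - k : ℕ) : ℝ≥0) + w) = ((n - k : ℕ) : ℝ≥0) + w := by
    rw [show n - k = 1 + (n - 1 - k) by lia]
    push_cast
    ring
  rw [e] at h
  simp only [hA, convPow]
  rw [show n - (k + 1) = n - 1 - k by lia]
  simpa only [NNReal.coe_add, NNReal.coe_natCast] using h

/-- In the Lindeberg sum, the Gaussian parts contribute `n` terms of size `n ^ (-3/2)`. The errors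
`D k` carry the weights `(n - 1 - k + w) ^ (-3/2)`, of total at most `4 / √w`; this converges
without a factor `n`, so the induction closes once `√w` is a large multiple of `ρ`. Undoing the
smoothing costs a multiple of `√w / √n`, which still has the order `ρ / √n`. -/
theorem exists_berryEsseen_standardized : ∃ K, 0 < K ∧ ∀ (μ : Measure ℝ) [IsProbabilityMeasure μ],
    MemLp id 3 μ → ∫ x, x ∂μ = 0 → ∫ x, x ^ 2 ∂μ = 1 → ∀ n : ℕ, 1 ≤ n → ∀ t,
    |(convPow μ n).real (Ici t) - (gaussianReal 0 (n : ℝ≥0)).real (Ici t)|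
      ≤ K * (∫ x, |x| ^ 3 ∂μ) / √(n : ℝ) := by
  obtain ⟨c, hc, H⟩ := exists_lindeberg_bound
  -- The recursion needs `16c + 32c(K/A) + 6A ≤ K`. Having `A ≥ 64c` makes the middle term at most
  -- `K/2`, and `K` is twice the sum of the other two.
  set A := 64 * c + 1 with hA
  have hA1 : 1 ≤ A := by linarith
  set K := 2 * (16 * c + 6 * A) with hK
  have hK0 : 0 < K := by positivity
  refine ⟨K, hK0, ?_⟩
  intro μ _ hμ e1 e2 n
  set ρ := ∫ x, |x| ^ 3 ∂μ with hρ
  have hρ1 : 1 ≤ ρ := one_le_integral_abs_pow_three hμ e2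
  induction n using Nat.strong_induction_on with
  | _ n ih =>
  intro hn t
  have hnpos : (0 : ℝ) < n := by exact_mod_cast hn
  have hn1 : (1 : ℝ) ≤ n := by exact_mod_cast hn
  have hsn : 0 < √(n : ℝ) := Real.sqrt_pos.2 hnpos
  have hsn2 : √(n : ℝ) ^ 2 = n := Real.sq_sqrt hnpos.le
  have hAρ : 1 ≤ A * ρ := by nlinarith
  set w : ℝ≥0 := ⟨(A * ρ) ^ 2, by positivity⟩ with hw
  have hwR : (w : ℝ) = (A * ρ) ^ 2 := rfl
  have hsw : √(w : ℝ) = A * ρ := by rw [hwR, Real.sqrt_sq (by positivity)]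
  have hw1 : 1 ≤ (w : ℝ) := by rw [hwR]; nlinarith
  have hw0 : w ≠ 0 := by
    intro h
    rw [h] at hw1
    norm_num at hw1
  -- For `k ≥ n/2` the induction hypothesis is of order `1/√n`. For smaller `k`, including `k = 0`,
  -- the trivial bound suffices because the Gaussian variance still present is at least `n/2`.
  set D : ℕ → ℝ := fun k => if n ≤ 2 * k then 2 * K * ρ / √n else 1 with hD
  have hDk : ∀ k < n, ∀ t,
      |(convPow μ k).real (Ici t) - (gaussianReal 0 (k : ℝ≥0)).real (Ici t)| ≤ D k := by
    intro k hk t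
    by_cases h : n ≤ 2 * k
    · simp only [hD, if_pos h]
      refine (ih k hk (by lia) t).trans ?_
      have hk0 : (0 : ℝ) < k := by exact_mod_cast (by lia : 0 < k)
      have h2 : √(n : ℝ) ≤ 2 * √(k : ℝ) := by
        rw [show (2 : ℝ) = √4 by rw [show (4 : ℝ) = 2 ^ 2 by norm_num, Real.sqrt_sq (by norm_num)],
          ← Real.sqrt_mul (by norm_num)]
        apply Real.sqrt_le_sqrt
        have : (n : ℝ) ≤ 2 * k := by exact_mod_cast h
        linarith
      rw [div_le_div_iff₀ (Real.sqrt_pos.2 hk0) hsn]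
      calc K * ρ * √(n : ℝ) ≤ K * ρ * (2 * √(k : ℝ)) := by gcongr
        _ = _ := by ring
    · simp only [hD, if_neg h]
      exact abs_real_sub_real_le_one _ _ _
  have hterm : ∀ k ∈ Finset.range n, c * (1 / √((k : ℝ) + ((n - 1 - k : ℕ) + w)) ^ 3
          + D k / √(((n - 1 - k : ℕ) : ℝ) + w) ^ 3) * (ρ + 1)
      ≤ c * (ρ + 1) * (4 / √(n : ℝ) ^ 3)
        + c * (ρ + 1) * (2 * K * ρ / √n) * (1 / √(((n - 1 - k : ℕ) : ℝ) + w) ^ 3) := by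
    intro k hk
    have hk' := Finset.mem_range.1 hk
    have hcast : ((n - 1 - k : ℕ) : ℝ) = n - 1 - k := by
      rw [Nat.cast_sub (by lia), Nat.cast_sub hn]
      simp
    have hs0 : 0 < ((n - 1 - k : ℕ) : ℝ) + w := by positivity
    have b1 : 1 / √((k : ℝ) + ((n - 1 - k : ℕ) + w)) ^ 3 ≤ 1 / √(n : ℝ) ^ 3 := by
      gcongr
      rw [hcast]
      linarith
    have b2 : D k / √(((n - 1 - k : ℕ) : ℝ) + w) ^ 3 ≤ 3 / √(n : ℝ) ^ 3 +
        (2 * K * ρ / √n) * (1 / √(((n - 1 - k : ℕ) : ℝ) + w) ^ 3) := by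
      by_cases h : n ≤ 2 * k
      · simp only [hD, if_pos h]
        have : 0 ≤ 3 / √(n : ℝ) ^ 3 := by positivity
        rw [div_eq_mul_one_div (2 * K * ρ / √n)]
        linarith
      · simp only [hD, if_neg h]
        have h3 : 0 ≤ (2 * K * ρ / √n) * (1 / √(((n - 1 - k : ℕ) : ℝ) + w) ^ 3) := by positivity
        have h4 : 1 / √(((n - 1 - k : ℕ) : ℝ) + w) ^ 3 ≤ 3 / √(n : ℝ) ^ 3 := by
          -- Here `n ≤ 2 (n - 1 - k + w)`, as `w ≥ 1`. The rational `10/7` exceeds `√2` and its cube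
          -- is below `3`.
          have h5 : √(n : ℝ) ≤ 10 / 7 * √(((n - 1 - k : ℕ) : ℝ) + w) := by
            rw [show (10 / 7 : ℝ) = √((10 / 7) ^ 2) by rw [Real.sqrt_sq (by norm_num)],
              ← Real.sqrt_mul (by norm_num)]
            apply Real.sqrt_le_sqrt
            have : (2 * k : ℝ) ≤ n := by exact_mod_cast (by lia : 2 * k ≤ n)
            rw [hcast]
            linarith
          rw [div_le_div_iff₀ (pow_pos (Real.sqrt_pos.2 hs0) 3) (by positivity), one_mul]
          calc √(n : ℝ) ^ 3 ≤ (10 / 7 * √(((n - 1 - k : ℕ) : ℝ) + w)) ^ 3 := by gcongr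
            _ = (10 / 7) ^ 3 * √(((n - 1 - k : ℕ) : ℝ) + w) ^ 3 := by rw [mul_pow]
            _ ≤ _ := by gcongr; norm_num
        linarith
    calc _ ≤ c * (1 / √(n : ℝ) ^ 3 + (3 / √(n : ℝ) ^ 3 +
          (2 * K * ρ / √n) * (1 / √(((n - 1 - k : ℕ) : ℝ) + w) ^ 3))) * (ρ + 1) := by gcongr
      _ = _ := by ring
  have hsum : ∑ k ∈ Finset.range n, 1 / √(((n - 1 - k : ℕ) : ℝ) + w) ^ 3 ≤ 4 / (A * ρ) := by
    rw [Finset.sum_range_reflect (fun j : ℕ => 1 / √((j : ℝ) + w) ^ 3) n, ← hsw]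
    exact sum_inv_sqrt_pow_three_le hw1 n
  have hsmooth : ∀ t, |(convPow μ n ∗ gaussianReal 0 w).real (Ici t)
        - (gaussianReal 0 (n : ℝ≥0) ∗ gaussianReal 0 w).real (Ici t)|
      ≤ 2 * c * ρ * (4 + 8 * K / A) / √n := by
    intro t
    refine (H μ hμ e1 e2 n w hw0 D hDk t).trans ((Finset.sum_le_sum hterm).trans ?_)
    rw [Finset.sum_add_distrib, Finset.sum_const, Finset.card_range, nsmul_eq_mul,
      ← Finset.mul_sum]
    calc _ ≤ n * (c * (2 * ρ) * (4 / √(n : ℝ) ^ 3))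
          + c * (2 * ρ) * (2 * K * ρ / √n) * (4 / (A * ρ)) := by
          gcongr <;> linarith
      _ = _ := by
          have e : (n : ℝ) * (4 / √(n : ℝ) ^ 3) = 4 / √n := by
            rw [pow_succ, hsn2]
            field_simp
          have e' : (n : ℝ) * (c * (2 * ρ) * (4 / √(n : ℝ) ^ 3)) = c * (2 * ρ) * (4 / √n) := by
            rw [← e]; ring
          rw [e']
          field_simp
          ring
  have hfin := abs_real_Ici_sub_le_of_conv (by positivity) (by positivity)
    (three_quarters_le_gaussianReal hw0) (abs_gaussianReal_Ici_sub_le hn) hsmooth t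
  refine hfin.trans ?_
  rw [hsw]
  have hKA : 32 * c * (K / A) ≤ K / 2 := by
    rw [← mul_div_assoc, div_le_div_iff₀ (by linarith) (by norm_num)]
    nlinarith
  have : 2 * (2 * c * ρ * (4 + 8 * K / A) / √n) + 3 * (2 * (A * ρ) * (1 / √n))
      = (16 * c + 32 * c * (K / A) + 6 * A) * ρ / √n := by ring
  rw [this]
  gcongr
  linarith

/-! ### General i.i.d. sums and the optimal Berry-Esseen constant -/

lemma map_sum_pi_eq_convPow (μ : Measure ℝ) [IsProbabilityMeasure μ] (n : ℕ) :
    (Measure.pi fun _ : Fin n => μ).map (fun z => ∑ i, z i) = convPow μ n := by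
  induction n with
  | zero =>
    simp only [Finset.univ_eq_empty, Finset.sum_empty, convPow]
    rw [Measure.map_const, measure_univ, one_smul]
  | succ n ih =>
    have h := measurePreserving_piFinSuccAbove (fun _ : Fin (n + 1) => μ) 0
    have e : (fun z : Fin (n + 1) → ℝ => ∑ i, z i)
        = (fun p : ℝ × ℝ => p.1 + p.2) ∘ Prod.map id (fun z : Fin n → ℝ => ∑ i, z i)
          ∘ MeasurableEquiv.piFinSuccAbove (fun _ => ℝ) 0 := by
      funext z
      simp [Fin.sum_univ_succ, MeasurableEquiv.piFinSuccAbove, Fin.insertNthEquiv,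
        Fin.tail]
    rw [e, ← Function.comp_assoc, ← Measure.map_map (by fun_prop) (by fun_prop), h.map_eq,
      ← Measure.map_map (by fun_prop) (by fun_prop),
      ← Measure.map_prod_map _ _ (by fun_prop) (by fun_prop), ih, Measure.map_id, convPow,
      Measure.conv_comm]
    rfl

/-- The affine map that centres and normalises a law on `ℝ`. -/
noncomputable def standardize (μ : Measure ℝ) (x : ℝ) : ℝ := (x - ∫ y, y ∂μ) / √(variance id μ)

lemma measurable_standardize (μ : Measure ℝ) : Measurable (standardize μ) := by
  unfold standardize
  fun_prop

section Standardize

variable {μ : Measure ℝ}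

lemma integral_sq_map_standardize (hv : 0 < variance id μ) :
    ∫ x, x ^ 2 ∂(μ.map (standardize μ)) = 1 := by
  rw [integral_map (measurable_standardize μ).aemeasurable (by fun_prop)]
  simp only [standardize, div_pow, Real.sq_sqrt hv.le]
  rw [integral_div, div_eq_one_iff_eq hv.ne', variance_eq_integral (by fun_prop)]
  rfl

lemma integral_abs_pow_three_map_standardize (hv : 0 < variance id μ) :
    ∫ x, |x| ^ 3 ∂(μ.map (standardize μ))
      = (∫ y, |y - ∫ x, x ∂μ| ^ 3 ∂μ) / variance id μ ^ (3 / 2 : ℝ) := by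
  have hrpow : variance id μ ^ (3 / 2 : ℝ) = √(variance id μ) ^ 3 := by
    rw [Real.sqrt_eq_rpow, ← Real.rpow_natCast, ← Real.rpow_mul hv.le]
    norm_num
  rw [integral_map (measurable_standardize μ).aemeasurable (by fun_prop), hrpow]
  simp only [standardize, abs_div, abs_of_pos (Real.sqrt_pos.2 hv), div_pow]
  rw [integral_div]

variable [IsProbabilityMeasure μ]

lemma memLp_map_standardize (hμ : MemLp id 3 μ) : MemLp id 3 (μ.map (standardize μ)) := by
  refine (memLp_map_measure_iff aestronglyMeasurable_id
    (measurable_standardize μ).aemeasurable).2 ?_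
  have h := (hμ.sub (memLp_const (∫ y, y ∂μ))).const_mul (√(variance id μ))⁻¹
  refine h.ae_eq (Eventually.of_forall fun x => ?_)
  simp [standardize, div_eq_inv_mul]

lemma integral_map_standardize (hμ : MemLp id 3 μ) : ∫ x, x ∂(μ.map (standardize μ)) = 0 := by
  have hint : Integrable (fun x : ℝ => x) μ := hμ.integrable (by norm_num)
  rw [integral_map (measurable_standardize μ).aemeasurable (by fun_prop)]
  simp only [standardize]
  rw [integral_div, integral_sub hint (integrable_const _)]
  simp

lemma isProbabilityMeasure_map_standardize : IsProbabilityMeasure (μ.map (standardize μ)) :=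
  Measure.isProbabilityMeasure_map (measurable_standardize μ).aemeasurable

lemma one_le_third_moment_div (hμ : MemLp id 3 μ) (hv : 0 < variance id μ) :
    1 ≤ (∫ y, |y - ∫ x, x ∂μ| ^ 3 ∂μ) / variance id μ ^ (3 / 2 : ℝ) := by
  have := isProbabilityMeasure_map_standardize (μ := μ)
  rw [← integral_abs_pow_three_map_standardize hv]
  exact one_le_integral_abs_pow_three (memLp_map_standardize hμ) (integral_sq_map_standardize hv)

end Standardize

/-- Ensures that `C₀` is the infimum of a nonempty set and not the default value `0` of `sInf`. -/
lemma exists_isBerryEsseenConstant : ∃ c, IsBerryEsseenConstant c := by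
  obtain ⟨K, hK, H⟩ := exists_berryEsseen_standardized
  refine ⟨K, ?_⟩
  intro μ _ hμ hv n hn t
  have hσ : 0 < √(variance id μ) := Real.sqrt_pos.2 hv
  have hn0 : (0 : ℝ) < n := by exact_mod_cast hn
  have hsn : 0 < √(n : ℝ) := Real.sqrt_pos.2 hn0
  have hprob := isProbabilityMeasure_map_standardize (μ := μ)
  have hgm := measurable_standardize μ
  have h := H (μ.map (standardize μ)) (memLp_map_standardize hμ) (integral_map_standardize hμ)
    (integral_sq_map_standardize hv) n hn (t * √(n : ℝ))
  have hset : (Measure.pi fun _ : Fin n => μ).real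
      {z | t ≤ 1 / √((n : ℝ) * variance id μ) * ∑ i, (z i - ∫ x, x ∂μ)}
      = (convPow (μ.map (standardize μ)) n).real (Ici (t * √(n : ℝ))) := by
    rw [← map_sum_pi_eq_convPow, ← Measure.pi_map_pi (fun _ => hgm.aemeasurable),
      Measure.map_map (by fun_prop) (by fun_prop),
      map_measureReal_apply (by fun_prop) measurableSet_Ici]
    congr 1
    ext z
    simp only [mem_ofPred_eq, mem_preimage, Function.comp, mem_Ici, standardize]
    rw [← Finset.sum_div, Real.sqrt_mul hn0.le, one_div_mul_eq_div,
      le_div_iff₀ (by positivity), le_div_iff₀ hσ, mul_assoc]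
  have hn' : (n : ℝ≥0) ≠ 0 := by exact_mod_cast (by lia : n ≠ 0)
  have hQ : (gaussianReal 0 (n : ℝ≥0)).real (Ici (t * √(n : ℝ))) = Q t := by
    rw [real_Ici_gaussianReal hn', Q_eq_Phi_neg]
    congr 1
    simp only [NNReal.coe_natCast]
    field_simp
  rw [hset, ← hQ]
  refine h.trans (le_of_eq ?_)
  rw [integral_abs_pow_three_map_standardize hv]
  field_simp

/-- The law of a fair sign. -/
noncomputable def fairSign : Measure ℝ :=
  (1 / 2 : ℝ≥0∞) • (Measure.dirac 1 + Measure.dirac (-1))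

instance isProbabilityMeasure_fairSign : IsProbabilityMeasure fairSign := by
  constructor
  simp only [fairSign, Measure.smul_apply, Measure.add_apply, measure_univ, smul_eq_mul, one_div]
  rw [one_add_one_eq_two, ENNReal.inv_mul_cancel (by norm_num) (by norm_num)]

lemma integral_fairSign (f : ℝ → ℝ) : ∫ x, f x ∂fairSign = (f 1 + f (-1)) / 2 := by
  rw [fairSign, integral_smul_measure, integral_add_measure]
  · simp [div_eq_inv_mul]
  · exact integrable_dirac (by simp)
  · exact integrable_dirac (by simp)

lemma memLp_fairSign : MemLp id 3 fairSign := by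
  refine MemLp.of_bound aestronglyMeasurable_id 1 ?_
  rw [fairSign]
  refine Measure.ae_smul_measure ?_ _
  rw [ae_add_measure_iff]
  constructor <;> simp [ae_dirac_eq]

lemma fairSign_real_Ici (t : ℝ) :
    fairSign.real (Ici t) = ((Ici t).indicator 1 1 + (Ici t).indicator 1 (-1)) / 2 := by
  rw [← integral_indicator_one measurableSet_Ici, integral_fairSign]

/-- For a single fair sign the tail falls from `1/2` at `t = 1` to `0` just beyond, while `Q` is
continuous. Hence `c` is at least both `1/2 - Q 1` and `Q 1`, whose sum is `1/2`. -/
lemma one_quarter_le_of_isBerryEsseenConstant {c : ℝ} (hc : IsBerryEsseenConstant c) :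
    1 / 4 ≤ c := by
  have e1 : ∫ x, x ∂fairSign = 0 := by
    rw [integral_fairSign (fun x => x)]
    norm_num
  have e2 : variance id fairSign = 1 := by
    rw [variance_of_integral_eq_zero (X := id) (by fun_prop) e1]
    simp only [id]
    rw [integral_fairSign (fun x => x ^ 2)]
    norm_num
  have e3 : ∫ x, |x - 0| ^ 3 ∂fairSign = 1 := by
    rw [integral_fairSign (fun x => |x - 0| ^ 3)]
    norm_num
  have h : ∀ t, |fairSign.real (Ici t) - Q t| ≤ c := by
    intro t
    have h := hc fairSign memLp_fairSign (by rw [e2]; norm_num) 1 le_rfl t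
    rw [e1, e2, e3] at h
    simp only [Nat.cast_one, mul_one, Real.sqrt_one, div_one, Real.one_rpow, one_mul, sub_zero,
      Finset.univ_unique, Finset.sum_singleton] at h
    have hp := measurePreserving_eval (fun _ : Fin 1 => fairSign) default
    rw [← hp.map_eq, map_measureReal_apply (measurable_pi_apply _) measurableSet_Ici]
    exact h
  have hQ : Continuous Q := continuous_const.sub continuous_Phi
  have h1 : Q 1 ≤ c := by
    refine le_of_tendsto (hQ.continuousWithinAt (s := Ioi 1) (x := 1)) ?_
    filter_upwards [self_mem_nhdsWithin] with t ht
    have ht' : (1 : ℝ) < t := ht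
    have := h t
    rw [fairSign_real_Ici] at this
    have a1 : (1 : ℝ) ∉ Ici t := by simp [ht']
    have a2 : (-1 : ℝ) ∉ Ici t := by simp; linarith
    rw [indicator_of_notMem a1, indicator_of_notMem a2] at this
    simp only [add_zero, zero_div, zero_sub, abs_neg] at this
    exact (le_abs_self _).trans this
  have h2 : 1 / 2 - Q 1 ≤ c := by
    have := h 1
    rw [fairSign_real_Ici] at this
    have a1 : (1 : ℝ) ∈ Ici (1 : ℝ) := by simp
    have a2 : (-1 : ℝ) ∉ Ici (1 : ℝ) := by simp
    rw [indicator_of_mem a1, indicator_of_notMem a2] at this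
    simp only [Pi.one_apply, add_zero] at this
    exact (le_abs_self _).trans this
  linarith

lemma one_quarter_le_C₀ : 1 / 4 ≤ C₀ :=
  le_csInf exists_isBerryEsseenConstant fun _ hc => one_quarter_le_of_isBerryEsseenConstant hc

/-- The Berry-Esseen theorem with the optimal constant. -/
theorem isBerryEsseenConstant_C₀ : IsBerryEsseenConstant C₀ := by
  intro μ _ hμ hv n hn t
  set X := (∫ y, |y - ∫ x, x ∂μ| ^ 3 ∂μ) / (variance id μ ^ (3 / 2 : ℝ) * √(n : ℝ)) with hX
  have hX0 : 0 ≤ X := by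
    have : 0 ≤ ∫ y, |y - ∫ x, x ∂μ| ^ 3 ∂μ := integral_nonneg fun y => by positivity
    positivity
  have h : ∀ c, IsBerryEsseenConstant c → |(Measure.pi (fun _ : Fin n => μ)).real
      {z | t ≤ 1 / √((n : ℝ) * variance id μ) * ∑ i, (z i - ∫ x, x ∂μ)} - Q t| ≤ c * X := by
    intro c hc
    rw [hX, ← mul_div_assoc]
    exact hc μ hμ hv n hn t
  rw [mul_div_assoc, ← hX]
  -- For `X > 0`, division makes the left side a lower bound of all admissible constants, so the
  -- infimum is admissible too.
  rcases hX0.eq_or_lt with h0 | h0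
  · obtain ⟨c, hc⟩ := exists_isBerryEsseenConstant
    have := h c hc
    rwa [← h0, mul_zero] at this ⊢
  · rw [← div_le_iff₀ h0]
    exact le_csInf exists_isBerryEsseenConstant fun c hc => (div_le_iff₀ h0).2 (h c hc)

/-! ### Inverse Gaussian distribution functions -/

lemma Phi_PhiInv {p : ℝ} (h0 : 0 < p) (h1 : p < 1) : Phi (PhiInv p) = p := by
  refine Function.invFun_eq (f := Phi) (b := p) ?_
  refine mem_range_of_exists_le_of_exists_ge continuous_Phi ?_ ?_
  · exact ((tendsto_cdf_atBot (gaussianReal 0 1)).eventually_le_const h0).exists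
  · exact ((tendsto_cdf_atTop (gaussianReal 0 1)).eventually_const_le h1).exists

lemma Q_QInv {p : ℝ} (h0 : 0 < p) (h1 : p < 1) : Q (QInv p) = p := by
  refine Function.invFun_eq (f := Q) (b := p) ⟨PhiInv (1 - p), ?_⟩
  rw [Q, Phi_PhiInv (by linarith) (by linarith)]
  ring

lemma Phi_QInv {p : ℝ} (h0 : 0 < p) (h1 : p < 1) : Phi (QInv p) = 1 - p := by
  have := Q_QInv h0 h1
  rw [Q] at this
  linarith

lemma Phi_zero : Phi 0 = 1 / 2 := by
  have h := Q_eq_Phi_neg 0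
  rw [Q, neg_zero] at h
  linarith

lemma le_PhiInv_of_Phi_le {x p : ℝ} (h0 : 0 < p) (h1 : p < 1) (h : Phi x ≤ p) : x ≤ PhiInv p := by
  rw [← strictMono_Phi.le_iff_le, Phi_PhiInv h0 h1]
  exact h

lemma mul_sub_le_Phi_sub {x y m : ℝ} (hxy : x ≤ y) (hm : ∀ z ∈ Icc x y, m ≤ gaussDensity z) :
    m * (y - x) ≤ Phi y - Phi x := by
  rcases hxy.eq_or_lt with rfl | h
  · simp
  obtain ⟨z, hz, hz'⟩ := exists_hasDerivAt_eq_slope Phi gaussDensity h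
    continuous_Phi.continuousOn (fun z _ => hasDerivAt_Phi z)
  have := hm z ⟨hz.1.le, hz.2.le⟩
  rw [hz', le_div_iff₀ (by linarith)] at this
  exact this

lemma continuous_Q : Continuous Q := continuous_const.sub continuous_Phi

lemma Q_sub_Q_le {x y : ℝ} (h : x ≤ y) : Q x - Q y ≤ (y - x) / √(2 * Real.pi) := by
  have h1 := (abs_le.1 (abs_Phi_sub_Phi_le y x)).2
  rw [abs_of_nonneg (by linarith)] at h1
  rw [Q, Q, div_eq_inv_mul]
  linarith

/-! ### Codes that list a finite set -/

lemma existsCode_of_finset {α : Type*} [MeasurableSpace α] (P : Measure α) [IsFiniteMeasure P]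
    {A : Finset α} (hA : A.Nonempty) {ε : ℝ} (h : P.real (A : Set α)ᶜ ≤ ε) :
    ExistsCode P A.card ε := by
  classical
  obtain ⟨a, ha⟩ := hA
  refine ⟨fun x => if hx : x ∈ A then A.equivFin ⟨x, hx⟩ else A.equivFin ⟨a, ha⟩,
    fun m => (A.equivFin.symm m : α), le_trans (measureReal_mono ?_) h⟩
  intro x hx hxA
  apply hx
  have hxA' : x ∈ A := hxA
  simp [hxA']

lemma minCodeSize_le {𝒳 : Type*} [MeasurableSpace 𝒳] {P : Measure 𝒳} {n M : ℕ} {ε : ℝ}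
    (h : ExistsCode (blockLaw P n) M ε) : minCodeSize P n ε ≤ M :=
  Nat.sInf_le h

lemma logb_minCodeSize_le {𝒳 : Type*} [MeasurableSpace 𝒳] {P : Measure 𝒳} {b : ℝ} (hb : 1 < b)
    {n M : ℕ} {ε y : ℝ} (h : ExistsCode (blockLaw P n) M ε) (hM : 1 ≤ M) (hy : (M : ℝ) ≤ y) :
    Real.logb b (minCodeSize P n ε) ≤ Real.logb b y := by
  have hM' : (1 : ℝ) ≤ M := by exact_mod_cast hM
  -- At size `0` the logarithm takes its default value `0`, and `1 ≤ M` makes the right side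
  -- nonnegative.
  rcases Nat.eq_zero_or_pos (minCodeSize P n ε) with h0 | h0
  · rw [h0, Nat.cast_zero, Real.logb_zero]
    exact Real.logb_nonneg hb (hM'.trans hy)
  · refine Real.logb_le_logb_of_le hb (by exact_mod_cast h0) (le_trans ?_ hy)
    exact_mod_cast minCodeSize_le h

/-! ### The information of a block -/

section Block

instance isProbabilityMeasure_blockLaw {𝒳 : Type*} [MeasurableSpace 𝒳] (P : Measure 𝒳)
    [IsProbabilityMeasure P] (n : ℕ) : IsProbabilityMeasure (blockLaw P n) := by
  unfold blockLaw
  infer_instance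

variable {𝒳 : Type*} [MeasurableSpace 𝒳] [DiscreteMeasurableSpace 𝒳] {P : Measure 𝒳} {b : ℝ}

lemma measurable_info (b : ℝ) (P : Measure 𝒳) : Measurable (info b P) :=
  Measurable.of_discrete

lemma thirdMoment_toReal : (thirdMoment b P).toReal
    = ∫ y, |y - ∫ x, x ∂(P.map (info b P))| ^ 3 ∂(P.map (info b P)) := by
  have hm := measurable_info b P
  rw [integral_map hm.aemeasurable (by fun_prop), integral_map hm.aemeasurable (by fun_prop),
    integral_eq_lintegral_of_nonneg_ae (Eventually.of_forall fun x => by positivity)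
      Measurable.of_discrete.aestronglyMeasurable]
  rfl

lemma variance_id_map_info : variance id (P.map (info b P)) = varentropy b P := by
  rw [variance_map aemeasurable_id (measurable_info b P).aemeasurable]
  rfl

lemma integral_map_info : ∫ x, x ∂(P.map (info b P)) = entropy b P := by
  rw [integral_map (measurable_info b P).aemeasurable (by fun_prop)]
  rfl

variable [IsProbabilityMeasure P]

/-- The argument adds the constant `entropy b P` back to the centred variable, whatever its value;
integrability of `info` then follows, so `entropy` is a genuine mean. -/
lemma memLp_info (hT : thirdMoment b P < ⊤) : MemLp (info b P) 3 P := by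
  have h : MemLp (fun x => info b P x - entropy b P) 3 P := by
    refine ⟨(measurable_info b P).sub_const _ |>.aestronglyMeasurable, ?_⟩
    rw [eLpNorm_lt_top_iff_lintegral_rpow_enorm_lt_top (by norm_num) (by norm_num)]
    refine lt_of_eq_of_lt (lintegral_congr fun x => ?_) hT
    rw [ENNReal.ofReal_pow (abs_nonneg _), ← Real.enorm_eq_ofReal_abs]
    norm_num
  have h2 := h.add (memLp_const (entropy b P))
  refine h2.ae_eq (Eventually.of_forall fun x => ?_)
  simp

/-- The information `∑ ı(xᵢ)` of a block. -/
noncomputable def blockInfo (b : ℝ) (P : Measure 𝒳) {n : ℕ} (x : Fin n → 𝒳) : ℝ :=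
  ∑ i, info b P (x i)

lemma one_le_thirdMoment_div (hV : 0 < varentropy b P) (hT : thirdMoment b P < ⊤) :
    1 ≤ (thirdMoment b P).toReal / varentropy b P ^ (3 / 2 : ℝ) := by
  have hm := measurable_info b P
  have := Measure.isProbabilityMeasure_map (μ := P) hm.aemeasurable
  rw [thirdMoment_toReal, ← variance_id_map_info]
  refine one_le_third_moment_div ?_ (by rwa [variance_id_map_info])
  exact (memLp_map_measure_iff aestronglyMeasurable_id hm.aemeasurable).2 (memLp_info hT)

lemma one_quarter_le_constB (hV : 0 < varentropy b P) (hT : thirdMoment b P < ⊤) :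
    1 / 4 ≤ constB b P := by
  rw [constB, mul_div_assoc]
  nlinarith [one_le_thirdMoment_div hV hT, one_quarter_le_C₀]

/-- `C ≥ 4B ≥ 1`. This makes `log C` nonnegative, as a bound on a nonnegative remainder requires. -/
lemma one_le_constC (hb : 1 < b) (hV : 0 < varentropy b P) (hT : thirdMoment b P < ⊤) :
    1 ≤ constC b P := by
  have h1 := one_quarter_le_constB hV hT
  have h2 : 0 ≤ Real.logb b 2 / √(2 * Real.pi * varentropy b P) :=
    div_nonneg (Real.logb_nonneg hb (by norm_num)) (Real.sqrt_nonneg _)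
  rw [constC]
  linarith

lemma abs_blockLaw_le_blockInfo_sub_Q_le (hV : 0 < varentropy b P) (hT : thirdMoment b P < ⊤)
    {n : ℕ} (hn : 1 ≤ n) (a : ℝ) :
    |(blockLaw P n).real {x | a ≤ blockInfo b P x}
      - Q ((a - n * entropy b P) / √(n * varentropy b P))| ≤ constB b P / √(n : ℝ) := by
  have hm := measurable_info b P
  have hp := Measure.isProbabilityMeasure_map (μ := P) hm.aemeasurable
  have hn0 : (0 : ℝ) < n := by exact_mod_cast hn
  have hs : 0 < √(n * varentropy b P) := Real.sqrt_pos.2 (by positivity)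
  have h := isBerryEsseenConstant_C₀ (P.map (info b P))
    ((memLp_map_measure_iff aestronglyMeasurable_id hm.aemeasurable).2 (memLp_info hT))
    (by rwa [variance_id_map_info]) n hn ((a - n * entropy b P) / √(n * varentropy b P))
  rw [← thirdMoment_toReal, variance_id_map_info, integral_map_info,
    ← Measure.pi_map_pi (fun _ => hm.aemeasurable),
    map_measureReal_apply (by fun_prop) (measurableSet_le (by fun_prop) (by fun_prop))] at h
  have hset : (fun (x : Fin n → 𝒳) i => info b P (x i)) ⁻¹'
      {z | (a - n * entropy b P) / √(n * varentropy b P) ≤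
        1 / √(n * varentropy b P) * ∑ i, (z i - entropy b P)} = {x | a ≤ blockInfo b P x} := by
    ext x
    simp only [mem_preimage, mem_ofPred_eq, blockInfo]
    rw [one_div_mul_eq_div, div_le_div_iff_of_pos_right hs]
    simp
  rw [hset] at h
  refine h.trans (le_of_eq ?_)
  rw [constB, div_div]

lemma abs_blockLaw_lt_blockInfo_sub_Q_le (hV : 0 < varentropy b P) (hT : thirdMoment b P < ⊤)
    {n : ℕ} (hn : 1 ≤ n) (a : ℝ) :
    |(blockLaw P n).real {x | a < blockInfo b P x}
      - Q ((a - n * entropy b P) / √(n * varentropy b P))| ≤ constB b P / √(n : ℝ) := by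
  have h := abs_blockLaw_le_blockInfo_sub_Q_le hV hT hn
  rw [abs_le]
  constructor
  -- The lower bound for the strict tail comes from non-strict tails at `c ↓ a`, by continuity of
  -- `Q`.
  · have hlim : Tendsto (fun c => Q ((c - n * entropy b P) / √(n * varentropy b P))
        - constB b P / √(n : ℝ)) (𝓝[>] a)
        (𝓝 (Q ((a - n * entropy b P) / √(n * varentropy b P)) - constB b P / √(n : ℝ))) := by
      apply Continuous.continuousWithinAt
      have := continuous_Q
      fun_prop
    have := le_of_tendsto hlim (b := (blockLaw P n).real {x | a < blockInfo b P x}) (by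
      filter_upwards [self_mem_nhdsWithin] with c hc
      have h1 := (abs_le.1 (h c)).1
      have h2 : (blockLaw P n).real {x | c ≤ blockInfo b P x}
          ≤ (blockLaw P n).real {x | a < blockInfo b P x} :=
        measureReal_mono fun x (hx : c ≤ _) => show a < _ from lt_of_lt_of_le hc hx
      linarith)
    linarith
  · have h1 := (abs_le.1 (h a)).2
    have h2 : (blockLaw P n).real {x | a < blockInfo b P x}
        ≤ (blockLaw P n).real {x | a ≤ blockInfo b P x} :=
      measureReal_mono fun x (hx : a < _) => show a ≤ _ from hx.le
    linarith

variable [Countable 𝒳]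

/-- Each window of length `log 2` carries probability at most `C / (2 √n)`. -/
lemma blockLaw_window_le (hV : 0 < varentropy b P) (hT : thirdMoment b P < ⊤) (hb : 1 < b)
    {n : ℕ} (hn : 1 ≤ n) (a : ℝ) :
    (blockLaw P n).real {x | a < blockInfo b P x ∧ blockInfo b P x ≤ a + Real.logb b 2}
      ≤ constC b P / 2 / √(n : ℝ) := by
  have hn0 : (0 : ℝ) < n := by exact_mod_cast hn
  have hs : 0 < √(n * varentropy b P) := Real.sqrt_pos.2 (by positivity)
  have hL : 0 ≤ Real.logb b 2 := Real.logb_nonneg hb (by norm_num)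
  have h1 := (abs_le.1 (abs_blockLaw_lt_blockInfo_sub_Q_le hV hT hn a)).2
  have h2 := (abs_le.1 (abs_blockLaw_lt_blockInfo_sub_Q_le hV hT hn (a + Real.logb b 2))).1
  have hdisj : Disjoint {x : Fin n → 𝒳 | a < blockInfo b P x ∧ blockInfo b P x ≤ a + Real.logb b 2}
      {x | a + Real.logb b 2 < blockInfo b P x} := by
    rw [Set.disjoint_left]
    intro x hx hx'
    exact absurd hx.2 (not_le.2 hx')
  have hsum := measureReal_union (μ := blockLaw P n) hdisj MeasurableSet.of_discrete
  have hmono : (blockLaw P n).real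
      ({x : Fin n → 𝒳 | a < blockInfo b P x ∧ blockInfo b P x ≤ a + Real.logb b 2} ∪
        {x | a + Real.logb b 2 < blockInfo b P x})
      ≤ (blockLaw P n).real {x | a < blockInfo b P x} := by
    refine measureReal_mono ?_
    rintro x (hx | hx)
    · exact hx.1
    · exact lt_of_le_of_lt (le_add_of_nonneg_right hL) hx
  -- The density is at most `1/√(2π)`, and a window of length `log 2` has normalised length `log 2 /
  -- √(nV)`. The two Berry-Esseen errors supply the term `2B`.
  have hQ := Q_sub_Q_le (x := (a - n * entropy b P) / √(n * varentropy b P))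
    (y := (a + Real.logb b 2 - n * entropy b P) / √(n * varentropy b P)) (by gcongr; linarith)
  have e : ((a + Real.logb b 2 - n * entropy b P) / √(n * varentropy b P)
      - (a - n * entropy b P) / √(n * varentropy b P)) / √(2 * Real.pi)
      = Real.logb b 2 / √(2 * Real.pi * varentropy b P) / √(n : ℝ) := by
    rw [← sub_div, div_div, div_div, ← Real.sqrt_mul (by positivity),
      ← Real.sqrt_mul (by positivity)]
    congr 1
    · ring
    · congr 1
      ring
  rw [e] at hQ
  have e2 : constC b P / 2 / √(n : ℝ)
      = Real.logb b 2 / √(2 * Real.pi * varentropy b P) / √(n : ℝ)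
        + 2 * (constB b P / √(n : ℝ)) := by
    rw [constC]
    ring
  rw [e2]
  linarith

end Block

/-! ### Counting blocks of low information and the rate of the listing code -/

section Achievability

variable {𝒳 : Type*} [MeasurableSpace 𝒳] {P : Measure 𝒳} [IsProbabilityMeasure P] {b : ℝ}

/-- The blocks of symbols of positive probability whose information is at most `β`. -/
def lowInfoBlocks (b : ℝ) (P : Measure 𝒳) (n : ℕ) (β : ℝ) : Set (Fin n → 𝒳) :=
  {x | (∀ i, 0 < P.real {x i}) ∧ blockInfo b P x ≤ β}

lemma blockLaw_singleton_mul_rpow (hb : 1 < b) {n : ℕ} {x : Fin n → 𝒳}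
    (hx : ∀ i, 0 < P.real {x i}) : (blockLaw P n).real {x} * b ^ blockInfo b P x = 1 := by
  have h1 : (blockLaw P n).real {x} = ∏ i, P.real {x i} := by
    rw [Measure.real, blockLaw, Measure.pi_singleton, ENNReal.toReal_prod]
    rfl
  rw [h1, blockInfo, Real.rpow_sum_of_pos (by linarith), ← Finset.prod_mul_distrib]
  refine Finset.prod_eq_one fun i _ => ?_
  rw [info, Real.rpow_logb (by linarith) hb.ne' (one_div_pos.2 (hx i)), mul_one_div,
    div_self (hx i).ne']

variable [Countable 𝒳] [DiscreteMeasurableSpace 𝒳]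

/-- A null symbol has `info` equal to `0`, since `logb b (1 / 0) = 0`, so its information says
nothing about its probability. Countability makes all null symbols together negligible, and
`lowInfoBlocks` may exclude them without raising the error. -/
lemma blockLaw_exists_null_symbol (P : Measure 𝒳) [IsProbabilityMeasure P] (n : ℕ) :
    (blockLaw P n).real {x | ∀ i, 0 < P.real {x i}}ᶜ = 0 := by
  have h0 : P {a | ¬ 0 < P.real {a}} = 0 := by
    refine (measure_null_iff_singleton (to_countable _)).2 fun a ha => ?_
    have ha' : ¬ 0 < P.real {a} := ha
    have : P.real {a} = 0 := le_antisymm (not_lt.1 ha') measureReal_nonneg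
    rwa [measureReal_eq_zero_iff] at this
  have h1 : ({x : Fin n → 𝒳 | ∀ i, 0 < P.real {x i}}ᶜ : Set (Fin n → 𝒳))
      = ⋃ i, Function.eval i ⁻¹' {a | ¬ 0 < P.real {a}} := by
    ext x
    simp
  rw [measureReal_eq_zero_iff, h1, measure_iUnion_null_iff]
  intro i
  rw [blockLaw, (measurePreserving_eval (fun _ : Fin n => P) i).measure_preimage
    MeasurableSet.of_discrete.nullMeasurableSet]
  exact h0

lemma blockLaw_compl_lowInfoBlocks_le (P : Measure 𝒳) [IsProbabilityMeasure P] (b : ℝ) (n : ℕ)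
    (β : ℝ) : (blockLaw P n).real (lowInfoBlocks b P n β)ᶜ
      ≤ (blockLaw P n).real {x | β < blockInfo b P x} := by
  have h : (lowInfoBlocks b P n β)ᶜ
      ⊆ {x | β < blockInfo b P x} ∪ {x | ∀ i, 0 < P.real {x i}}ᶜ := by
    intro x hx
    by_cases hx' : ∀ i, 0 < P.real {x i}
    · left
      by_contra hle
      exact hx ⟨hx', not_lt.1 hle⟩
    · exact Or.inr hx'
  refine (measureReal_mono h).trans ((measureReal_union_le _ _).trans ?_)
  rw [blockLaw_exists_null_symbol, add_zero]

/-- Dyadic counting bound for the blocks of low information. -/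
lemma card_le_of_subset_lowInfoBlocks (hb : 1 < b) (hV : 0 < varentropy b P)
    (hT : thirdMoment b P < ⊤) {n : ℕ} (hn : 1 ≤ n) {β : ℝ} {F : Finset (Fin n → 𝒳)}
    (hF : (F : Set (Fin n → 𝒳)) ⊆ lowInfoBlocks b P n β) :
    (F.card : ℝ) ≤ constC b P * b ^ β / √(n : ℝ) := by
  classical
  have hb0 : 0 < b := by linarith
  set L := Real.logb b 2 with hL
  have hL0 : 0 < L := Real.logb_pos hb (by norm_num)
  have hbL : b ^ L = 2 := Real.rpow_logb hb0 hb.ne' (by norm_num)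
  set W := constC b P / 2 / √(n : ℝ) with hW
  have hC : 0 ≤ constC b P := by linarith [one_le_constC hb hV hT]
  have hW0 : 0 ≤ W := by positivity
  -- The index of the window of length `log 2` below `β` that contains the information of `x`.
  set j : (Fin n → 𝒳) → ℕ := fun x => ⌊(β - blockInfo b P x) / L⌋₊ with hj
  have hjle : ∀ x ∈ F, blockInfo b P x ≤ β - j x * L ∧ β - j x * L - L < blockInfo b P x := by
    intro x hx
    have hxβ : blockInfo b P x ≤ β := (hF hx).2
    have h0 : 0 ≤ (β - blockInfo b P x) / L := div_nonneg (by linarith) hL0.le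
    have h1 := Nat.floor_le h0
    have h2 := Nat.lt_floor_add_one ((β - blockInfo b P x) / L)
    rw [le_div_iff₀ hL0] at h1
    rw [div_lt_iff₀ hL0] at h2
    simp only [hj]
    constructor <;> linarith
  -- Each block is counted as `1 = b ^ ı(x) * P(x)`, and `b ^ ı(x) ≤ b ^ β * 2 ^ (-j x)`, so
  -- cardinality is bounded by weighted probability.
  have hterm : ∀ x ∈ F, (1 : ℝ) ≤ b ^ β * (1 / 2) ^ j x * (blockLaw P n).real {x} := by
    intro x hx
    have h1 := blockLaw_singleton_mul_rpow hb (hF hx).1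
    have h2 : b ^ blockInfo b P x ≤ b ^ β * (1 / 2) ^ j x := by
      calc b ^ blockInfo b P x ≤ b ^ (β - j x * L) :=
            Real.rpow_le_rpow_of_exponent_le hb.le (hjle x hx).1
        _ = _ := by
            rw [Real.rpow_sub hb0, mul_comm (j x : ℝ) L, Real.rpow_mul hb0.le, hbL,
              Real.rpow_natCast, one_div, inv_pow, div_eq_mul_inv]
    calc (1 : ℝ) = b ^ blockInfo b P x * (blockLaw P n).real {x} := by rw [← h1, mul_comm]
      _ ≤ _ := by gcongr
  have hfib : ∀ k ∈ F.image j, ∑ x ∈ F with j x = k,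
      b ^ β * (1 / 2) ^ j x * (blockLaw P n).real {x} ≤ b ^ β * W * (1 / 2) ^ k := by
    intro k _
    have h1 : ∑ x ∈ F with j x = k, b ^ β * (1 / 2) ^ j x * (blockLaw P n).real {x}
        = b ^ β * (1 / 2) ^ k * ∑ x ∈ F with j x = k, (blockLaw P n).real {x} := by
      rw [Finset.mul_sum]
      refine Finset.sum_congr rfl fun x hx => ?_
      rw [(Finset.mem_filter.1 hx).2]
    have h2 : ∑ x ∈ F with j x = k, (blockLaw P n).real {x} ≤ W := by
      rw [sum_measureReal_singleton]
      refine le_trans (measureReal_mono ?_)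
        (blockLaw_window_le hV hT hb hn (β - k * L - L))
      intro x hx
      obtain ⟨hxF, hxk⟩ := Finset.mem_filter.1 (Finset.mem_coe.1 hx)
      have := hjle x hxF
      rw [hxk] at this
      exact ⟨this.2, by rw [← hL]; linarith [this.1]⟩
    rw [h1]
    calc b ^ β * (1 / 2) ^ k * ∑ x ∈ F with j x = k, (blockLaw P n).real {x}
        ≤ b ^ β * (1 / 2) ^ k * W := by gcongr
      _ = _ := by ring
  have hgeo : ∑ k ∈ F.image j, (1 / 2 : ℝ) ^ k ≤ 2 :=
    (summable_geometric_two.sum_le_tsum _ fun k _ => by positivity).trans_eq tsum_geometric_two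
  calc (F.card : ℝ) = ∑ x ∈ F, (1 : ℝ) := by simp
    _ ≤ ∑ x ∈ F, b ^ β * (1 / 2) ^ j x * (blockLaw P n).real {x} := Finset.sum_le_sum hterm
    _ = ∑ k ∈ F.image j, ∑ x ∈ F with j x = k,
          b ^ β * (1 / 2) ^ j x * (blockLaw P n).real {x} :=
        (Finset.sum_fiberwise_of_maps_to (fun x hx => Finset.mem_image_of_mem j hx) _).symm
    _ ≤ ∑ k ∈ F.image j, b ^ β * W * (1 / 2) ^ k := Finset.sum_le_sum hfib
    _ = b ^ β * W * ∑ k ∈ F.image j, (1 / 2 : ℝ) ^ k := by rw [Finset.mul_sum]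
    _ ≤ b ^ β * W * 2 := by gcongr
    _ = _ := by rw [hW]; ring

lemma finite_lowInfoBlocks (hb : 1 < b) (hV : 0 < varentropy b P) (hT : thirdMoment b P < ⊤)
    {n : ℕ} (hn : 1 ≤ n) (β : ℝ) : (lowInfoBlocks b P n β).Finite := by
  by_contra hinf
  obtain ⟨k, hk⟩ := exists_nat_gt (constC b P * b ^ β / √(n : ℝ))
  obtain ⟨F, hF, hFk⟩ := Set.Infinite.exists_subset_card_eq hinf k
  have := card_le_of_subset_lowInfoBlocks hb hV hT hn hF
  rw [hFk] at this
  linarith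

/-- The code that lists the blocks of low information. -/
lemma minRate_le (hb : 1 < b) (hV : 0 < varentropy b P) (hT : thirdMoment b P < ⊤)
    {n : ℕ} (hn : 1 ≤ n) {ε : ℝ} (hε1 : ε < 1) (hB : constB b P / √(n : ℝ) < ε) :
    minRate b P n ε ≤ entropy b P
      + √(varentropy b P / n) * QInv (ε - constB b P / √(n : ℝ))
      - Real.logb b n / (2 * n) + 1 / n * Real.logb b (constC b P) := by
  have hb0 : 0 < b := by linarith
  have hn0 : (0 : ℝ) < n := by exact_mod_cast hn
  have hsn : 0 < √(n : ℝ) := Real.sqrt_pos.2 hn0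
  have hs : 0 < √(n * varentropy b P) := Real.sqrt_pos.2 (by positivity)
  have hC : 1 ≤ constC b P := one_le_constC hb hV hT
  have hB0 : 0 ≤ constB b P / √(n : ℝ) :=
    div_nonneg (by linarith [one_quarter_le_constB hV hT]) hsn.le
  set z := QInv (ε - constB b P / √(n : ℝ)) with hz
  -- The slack `B/√n` in the argument of `QInv` pays for the Berry-Esseen error.
  set β := n * entropy b P + √(n * varentropy b P) * z with hβ
  have herr : (blockLaw P n).real (lowInfoBlocks b P n β)ᶜ ≤ ε := by
    refine (blockLaw_compl_lowInfoBlocks_le P b n β).trans ?_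
    have h := (abs_le.1 (abs_blockLaw_lt_blockInfo_sub_Q_le hV hT hn β)).2
    have e : (β - n * entropy b P) / √(n * varentropy b P) = z := by
      rw [hβ, add_sub_cancel_left, mul_div_cancel_left₀ _ hs.ne']
    rw [e, hz, Q_QInv (by linarith) (by linarith)] at h
    linarith
  set A := (finite_lowInfoBlocks hb hV hT hn β).toFinset with hA
  have hAcoe : (A : Set (Fin n → 𝒳)) = lowInfoBlocks b P n β := by simp [hA]
  -- An empty list would err with probability `1 > ε`.
  have hAne : A.Nonempty := by
    rw [Finset.nonempty_iff_ne_empty]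
    intro h0
    rw [← hAcoe, h0, Finset.coe_empty, compl_empty, probReal_univ] at herr
    linarith
  have hcode := existsCode_of_finset (blockLaw P n) hAne (ε := ε) (by rwa [hAcoe])
  have hcard := card_le_of_subset_lowInfoBlocks hb hV hT hn hAcoe.le
  have hlog := logb_minCodeSize_le hb hcode hAne.card_pos hcard
  have hval : Real.logb b (constC b P * b ^ β / √(n : ℝ))
      = Real.logb b (constC b P) + β - Real.logb b n / 2 := by
    have hbβ : 0 < b ^ β := Real.rpow_pos_of_pos hb0 β
    rw [Real.logb_div (by positivity) hsn.ne', Real.logb_mul (by positivity) hbβ.ne',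
      Real.logb_rpow hb0 hb.ne', Real.sqrt_eq_rpow, Real.logb_rpow_eq_mul_logb_of_pos hn0]
    ring
  rw [hval] at hlog
  have hsq : √(varentropy b P / n) = √(n * varentropy b P) / n := by
    rw [Real.sqrt_div hV.le, Real.sqrt_mul hn0.le]
    field_simp
    rw [Real.sq_sqrt hn0.le]
  calc minRate b P n ε
      ≤ 1 / n * (Real.logb b (constC b P) + β - Real.logb b n / 2) := by
        rw [minRate]
        gcongr
    _ = _ := by
        rw [hsq, hβ]
        field_simp
        ring

/-- The remainder left after the Gaussian approximation, given a lower bound `m` for the Gaussian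
density between the two quantiles involved. -/
lemma minRate_sub_le (hb : 1 < b) (hV : 0 < varentropy b P) (hT : thirdMoment b P < ⊤)
    {n : ℕ} (hn : 1 ≤ n) {ε : ℝ} (hε1 : ε < 1) (hB : constB b P / √(n : ℝ) < ε) {m : ℝ}
    (hm0 : 0 < m)
    (hm : ∀ z, QInv ε ≤ z → Phi z ≤ 1 - ε + constB b P / √(n : ℝ) → m ≤ gaussDensity z) :
    minRate b P n ε - (entropy b P + √(varentropy b P / n) * QInv ε - Real.logb b n / (2 * n))
      ≤ 1 / n * Real.logb b (constC b P)
        + 1 / n * (√(varentropy b P) * (constB b P + constC b P) / m) := by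
  have hn0 : (0 : ℝ) < n := by exact_mod_cast hn
  have hsn : 0 < √(n : ℝ) := Real.sqrt_pos.2 hn0
  have hC : 1 ≤ constC b P := one_le_constC hb hV hT
  have hB0 : 0 ≤ constB b P / √(n : ℝ) :=
    div_nonneg (by linarith [one_quarter_le_constB hV hT]) hsn.le
  set δ := constB b P / √(n : ℝ) with hδ
  have hrate := minRate_le hb hV hT hn hε1 hB
  have hP1 := Phi_QInv (p := ε) (by linarith) hε1
  have hP2 := Phi_QInv (p := ε - δ) (by linarith) (by linarith)
  have hle : QInv ε ≤ QInv (ε - δ) := by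
    rw [← strictMono_Phi.le_iff_le]
    linarith
  -- Mean value theorem for `Phi` between the two quantiles, whose levels differ by exactly `δ`.
  have hmv := mul_sub_le_Phi_sub hle (m := m) fun z hz => hm z hz.1
    ((strictMono_Phi.monotone hz.2).trans (by linarith))
  rw [hP1, hP2] at hmv
  have hq : QInv (ε - δ) - QInv ε ≤ δ / m := by
    rw [le_div_iff₀ hm0]
    linarith
  have hmul : √(varentropy b P / n) * (QInv (ε - δ) - QInv ε)
      ≤ 1 / n * (√(varentropy b P) * (constB b P + constC b P) / m) := by
    calc _ ≤ √(varentropy b P / n) * (δ / m) := by gcongr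
      _ = 1 / n * (√(varentropy b P) * constB b P / m) := by
          rw [hδ, Real.sqrt_div hV.le]
          field_simp
          rw [Real.sq_sqrt hn0.le, mul_comm]
      _ ≤ _ := by
          gcongr
          linarith
  linarith

end Achievability

/-! ### Density bounds between the quantiles and the choice of remainder -/

lemma div_sqrt_lt_of_sq_lt {K η : ℝ} (hK : 0 ≤ K) (hη : 0 < η) {n : ℕ}
    (h : (K / η) ^ 2 < (n : ℝ)) : K / √(n : ℝ) < η := by
  have h1 : K / η < √(n : ℝ) := (Real.lt_sqrt (by positivity)).2 h
  have h2 : 0 < √(n : ℝ) := lt_of_le_of_lt (by positivity) h1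
  rw [div_lt_iff₀ hη] at h1
  rw [div_lt_iff₀ h2]
  linarith

lemma QInv_nonneg {ε : ℝ} (h0 : 0 < ε) (h : ε ≤ 1 / 2) : 0 ≤ QInv ε := by
  rw [← strictMono_Phi.le_iff_le, Phi_zero, Phi_QInv h0 (by linarith)]
  linarith

/-- On the upper half of the distribution, the density decreases. -/
lemma gaussDensity_PhiInv_le {p z : ℝ} (h1 : p < 1) (hz0 : 0 ≤ z) (hz : Phi z ≤ p) :
    gaussDensity (PhiInv p) ≤ gaussDensity z := by
  have hp0 : 0 < p := by
    have := strictMono_Phi.monotone hz0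
    rw [Phi_zero] at this
    linarith
  have h := le_PhiInv_of_Phi_le hp0 h1 hz
  exact gaussDensity_le_of_sq_le (by gcongr)

/-- On the lower half of the distribution, the density increases. -/
lemma gaussDensity_le_of_le_of_Phi_le {x z : ℝ} (hxz : x ≤ z) (hz : Phi z ≤ 1 / 2) :
    gaussDensity x ≤ gaussDensity z := by
  have hz0 : z ≤ 0 := by
    rw [← strictMono_Phi.le_iff_le, Phi_zero]
    exact hz
  exact gaussDensity_le_of_sq_le (by nlinarith)

end SourceCoding

open SourceCoding in
theorem theorem5 {𝒳 : Type*} [Countable 𝒳] [MeasurableSpace 𝒳] [DiscreteMeasurableSpace 𝒳]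
    (P : Measure 𝒳) [IsProbabilityMeasure P] (b : ℝ) (hb : 1 < b)
    (hV : 0 < SourceCoding.varentropy b P) (hT : SourceCoding.thirdMoment b P < ⊤)
    (ε : ℝ) (hε0 : 0 < ε) (hε1 : ε < 1) :
    ∃ ξ : ℕ → ℝ,
      (∀ n : ℕ, 1 ≤ n →
        SourceCoding.minRate b P n ε ≤
          SourceCoding.entropy b P
            + √(SourceCoding.varentropy b P / (n : ℝ)) * SourceCoding.QInv ε
            - Real.logb b (n : ℝ) / (2 * (n : ℝ)) + ξ n) ∧
      SourceCoding.IsNonnegBigO ξ (fun n => 1 / (n : ℝ)) ∧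
      (ε ≤ 1 / 2 → ∀ n : ℕ,
        ((SourceCoding.constB b P + SourceCoding.constC b P) / ε) ^ 2 < (n : ℝ) →
        ξ n ≤ 1 / (n : ℝ) * Real.logb b (SourceCoding.constC b P)
          + 1 / (n : ℝ) *
            (√(SourceCoding.varentropy b P) *
                (SourceCoding.constB b P + SourceCoding.constC b P) /
              SourceCoding.gaussDensity (SourceCoding.PhiInv
                (SourceCoding.Phi (SourceCoding.QInv ε)
                  + (SourceCoding.constB b P + SourceCoding.constC b P) / √(n : ℝ))))) ∧
      (1 / 2 < ε → ∀ n : ℕ,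
        ((SourceCoding.constB b P + SourceCoding.constC b P) / (ε - 1 / 2)) ^ 2 < (n : ℝ) →
        ξ n ≤ 1 / (n : ℝ) * Real.logb b (SourceCoding.constC b P)
          + 1 / (n : ℝ) *
            (√(SourceCoding.varentropy b P) *
                (SourceCoding.constB b P + SourceCoding.constC b P) /
              SourceCoding.gaussDensity (SourceCoding.QInv ε))) := by
  set B := constB b P with hB
  set C := constC b P with hC
  have hB0 : 0 ≤ B := by linarith [one_quarter_le_constB hV hT]
  have hC1 : 1 ≤ C := one_le_constC hb hV hT
  have hlogC : 0 ≤ Real.logb b C := Real.logb_nonneg hb hC1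
  set gap : ℕ → ℝ := fun n => minRate b P n ε - (entropy b P
    + √(varentropy b P / n) * QInv ε - Real.logb b n / (2 * n)) with hgap
  set bound : ℕ → ℝ → ℝ := fun n m => 1 / n * Real.logb b C
    + 1 / n * (√(varentropy b P) * (B + C) / m) with hbound
  have hξ : ∀ (n : ℕ) (m η : ℝ), 0 < m → 0 < η → η ≤ ε → ((B + C) / η) ^ 2 < (n : ℝ) →
      (∀ z, QInv ε ≤ z → Phi z ≤ 1 - ε + B / √(n : ℝ) → m ≤ gaussDensity z) →
      max 0 (gap n) ≤ bound n m := by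
    intro n m η hm0 hη hηε hn hm
    have hn1 : 1 ≤ n := by
      have : (0 : ℝ) < n := lt_of_le_of_lt (by positivity) hn
      exact_mod_cast this
    have hlt := div_sqrt_lt_of_sq_lt (by positivity) hη hn
    have hBlt : B / √(n : ℝ) < ε := by
      have : B / √(n : ℝ) ≤ (B + C) / √(n : ℝ) := by gcongr; linarith
      linarith
    refine max_le (by positivity) ?_
    exact minRate_sub_le hb hV hT hn1 hε1 hBlt hm0 hm
  have hBC : ∀ n : ℕ, B / √(n : ℝ) ≤ (B + C) / √(n : ℝ) := fun n => by gcongr; linarith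
  have hPhi := Phi_QInv hε0 hε1
  have case1 : ε ≤ 1 / 2 → ∀ (n : ℕ) (p : ℝ), ((B + C) / ε) ^ 2 < (n : ℝ) → p < 1 →
      1 - ε + (B + C) / √(n : ℝ) ≤ p → max 0 (gap n) ≤ bound n (gaussDensity (PhiInv p)) := by
    intro h n p hn hp1 hp
    refine hξ n _ ε (gaussDensity_pos _) hε0 le_rfl hn fun z hz hz' => ?_
    exact gaussDensity_PhiInv_le hp1 ((QInv_nonneg hε0 h).trans hz) (by linarith [hBC n])
  have case2 : 1 / 2 < ε → ∀ n : ℕ, ((B + C) / (ε - 1 / 2)) ^ 2 < (n : ℝ) →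
      max 0 (gap n) ≤ bound n (gaussDensity (QInv ε)) := by
    intro h n hn
    have hlt := div_sqrt_lt_of_sq_lt (by positivity) (by linarith) hn
    -- The condition on `n` keeps the upper level `1 - ε + B/√n` below `1/2`, so both quantiles are
    -- nonpositive and the density is least at the left one, `QInv ε`.
    refine hξ n _ (ε - 1 / 2) (gaussDensity_pos _) (by linarith) (by linarith) hn fun z hz hz' => ?_
    exact gaussDensity_le_of_le_of_Phi_le hz (by linarith [hBC n])
  -- The smallest nonnegative remainder is the witness: the rate inequality then holds for every
  -- `n`, and only the bounds need `n` large.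
  refine ⟨fun n => max 0 (gap n), fun n _ => ?_, ?_, fun h n hn => ?_, case2⟩
  · have := le_max_right 0 (gap n)
    simp only [hgap] at this ⊢
    linarith
  · have key : ∀ m n₀ : ℝ, 0 < m → 0 ≤ n₀ →
        (∀ n : ℕ, n₀ < (n : ℝ) → max 0 (gap n) ≤ bound n m) →
        IsNonnegBigO (fun n => max 0 (gap n)) (fun n => 1 / (n : ℝ)) := by
      intro m n₀ hm hn₀ h
      refine ⟨Real.logb b C + √(varentropy b P) * (B + C) / m, n₀, by positivity, hn₀,
        fun n hn => ⟨le_max_left _ _, (h n hn).trans (le_of_eq ?_)⟩⟩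
      simp only [hbound]
      ring
    rcases le_or_gt ε (1 / 2) with h | h
    -- The constant in `O(1/n)` must not depend on `n`. Once `(B + C)/√n < ε/2`, the fixed level `1
    -- - ε/2 < 1` dominates `1 - ε + (B + C)/√n`.
    · refine key (gaussDensity (PhiInv (1 - ε / 2))) (((B + C) / (ε / 2)) ^ 2)
        (gaussDensity_pos _) (by positivity) fun n hn => ?_
      have hlt := div_sqrt_lt_of_sq_lt (by positivity) (by positivity) hn
      refine case1 h n _ (lt_of_le_of_lt ?_ hn) (by linarith) (by linarith)
      gcongr
      linarith
    · exact key _ _ (gaussDensity_pos _) (by positivity) (case2 h)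
  · rw [hPhi]
    have hlt := div_sqrt_lt_of_sq_lt (by positivity) hε0 hn
    exact case1 h n _ hn (by linarith) le_rfl
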